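/- Let $\xi_1,\xi_2,\dots$ be i.i.d. complex random variables, let $u_0\in\mathbb C$, and put $P_n(z)=(z-u_0)\prod_{k=1}^n(z-\xi_k)$. Assume that on some disk of positive radius around $u_0$ the law of $\xi_1$ has a density $p\ge 0$ with respect to Lebesgue measure, that $p$ is continuous at $u_0$ (outside this disk the law is arbitrary), and that $f(u_0)\neq 0$, where $f(z)=\mathbb E\big[\frac1{z-\xi_1}\big]$ is the Cauchy–Stieltjes transform. Let $r_1,r_2,\dots>0$ satisfy $nr_n\to\infty$ and $\sqrt n\,r_n\to 0$ as $n\to\infty$, and let $\bar{\mathbb B}_{r}(u_0)=\{z\in\mathbb C:|z-u_0|\le r\}$. (a) $\displaystyle\lim_{n\to\infty}\mathbb P\big[\text{there is a unique }\zeta\in\bar{\mathbb B}_{r_n}(u_0)\text{ such that }P_n'(\zeta)=0\big]=1.$ (b) Let $\zeta_n$ be this unique critical point if it exists uniquely, and an arbitrary complex value, depending measurably on the random outcome, otherwise. Then $\zeta_n$ is a random variable, and $$f(u_0)^2\sqrt{\frac{n}{\log n}}\Big(n(\zeta_n-u_0)+\frac1{f(u_0)}\Big)\xrightarrow[n\to\infty]{d}N_{\mathbb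 C}(0,\pi p(u_0)).$$ Here $N_{\mathbb C}(0,\sigma^2)$, $\sigma^2\ge0$, denotes the law of $X+iY$ with $X,Y$ independent real normal variables of mean $0$ and variance $\sigma^2/2$ (the unit mass at $0$ if $\sigma^2=0$). -/

import Mathlib

open MeasureTheory ProbabilityTheory Filter Topology
open scoped NNReal ENNReal

/-- The complex normal law `N_ℂ(0, v)`: the law of `X + i Y` with `X`, `Y` independent real normal
variables of mean `0` and variance `v / 2` (the unit mass at `0` if `v = 0`). -/
noncomputable def complexNormal (v : ℝ≥0) : Measure ℂ :=
  ((gaussianReal 0 (v / 2)).prod (gaussianReal 0 (v / 2))).map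
    (fun x : ℝ × ℝ => (x.1 : ℂ) + (x.2 : ℂ) * Complex.I)

instance complexNormal.instIsProbabilityMeasure (v : ℝ≥0) :
    IsProbabilityMeasure (complexNormal v) :=
  Measure.isProbabilityMeasure_map (by fun_prop)

/-- On the set `s`, the measure `ν` on the complex plane has the density `p` with respect to
Lebesgue measure. Nothing is said about `ν` outside `s`. -/
def HasLebesgueDensityOn (ν : Measure ℂ) (p : ℂ → ℝ) (s : Set ℂ) : Prop :=
  AEMeasurable p (volume.restrict s) ∧ (∀ z ∈ s, 0 ≤ p z) ∧
    ∀ A : Set ℂ, MeasurableSet A → A ⊆ s → ν A = ∫⁻ z in A, ENNReal.ofReal (p z)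

/-- The Cauchy–Stieltjes transform `z ↦ 𝔼[1 / (z - X)]` of a complex random variable `X`.
The value is `0` if the expectation does not exist, so a non-zero value entails integrability. -/
noncomputable def cauchyStieltjes {Ω : Type*} [MeasurableSpace Ω] (μ : Measure Ω) (X : Ω → ℂ)
    (z : ℂ) : ℂ :=
  ∫ ω, 1 / (z - X ω) ∂μ

/-- The polynomial `(z - u₀) ∏_{k < n} (z - x k)`. -/
noncomputable def pinnedPoly (u₀ : ℂ) (x : ℕ → ℂ) (n : ℕ) : Polynomial ℂ :=
  (Polynomial.X - Polynomial.C u₀) * ∏ k ∈ Finset.range n, (Polynomial.X - Polynomial.C (x k))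

/-- The polynomial `P` has exactly one critical point in the closed disk of radius `r` around
`u`. -/
def HasUniqueCriticalPoint (P : Polynomial ℂ) (u : ℂ) (r : ℝ) : Prop :=
  ∃! ζ : ℂ, ζ ∈ Metric.closedBall u r ∧ P.derivative.eval ζ = 0

open Classical in
/-- The critical point of `P` in the closed disk of radius `r` around `u` if it exists uniquely,
and the prescribed value `a` otherwise. -/
noncomputable def criticalPointOr (P : Polynomial ℂ) (u : ℂ) (r : ℝ) (a : ℂ) : ℂ :=
  if h : HasUniqueCriticalPoint P u r then h.exists.choose else a

/-! Away from the zeros of the product, $P_n'(z)=0$ says $(z-u)g(z)=-1$ with $g(z)=\sum_k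
1/(z-\xi_k)$, so critical points near $u$ are fixed points of $z\mapsto u-1/g(z)$. Put $S=g(u)$ and
$T=\sum_k|u-\xi_k|^{-2}$. The law of large numbers gives $S\approx nf$, and $T$ controls the
variation of $g$ on the disk. If no $\xi_k$ is within $2r$ of $u$ and $T$ is not too large, the map
is a contraction of the disk (`hasUniqueCriticalPoint_of_bounds`), which gives a unique critical
point $\zeta=u-1/g(\zeta)$.

With $s=\sqrt{n\log n}$ and $A=-fn(\zeta-u)=fn/g(\zeta)$, the normalized quantity equals
$A\,(S-nf)/s+A\,(g(\zeta)-S)/s$ exactly. Here $A\to1$ in probability. The second term is at most a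
constant times $T/n^{3/2}$ on the good event (`criticalPoint_expansion`), hence negligible: $T$ may
have infinite mean, but its truncation at level $n$ has mean $O(n\log n)$
(`tendsto_measure_sum_inv_sq_ge`). Slutsky's lemma leaves a central limit theorem for $S$.

The summands $Y=1/(u-\xi)$ are on the edge of finite variance: the density at $u$ makes the second
moment of $\langle Y,t\rangle$, truncated at $|Y|\le b$, grow like $\pi p(u)|t|^2\log b$. The cutoff
$b=\sqrt n$ and $\log\sqrt n=\frac12\log n$ turn the norming $s$ into the limiting characteristic
function $\exp(-\pi p(u)|t|^2/4)$ (`tendsto_nat_mul_integral_exp_sub_one`). -/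

/-! ### Deterministic analysis of critical points near the pinned zero -/

/-- The logarithmic derivative of a product of linear factors away from its zeros. -/
theorem eval_derivative_prod_X_sub_C (x : ℕ → ℂ) (n : ℕ) (z : ℂ)
    (hz : ∀ k ∈ Finset.range n, z - x k ≠ 0) :
    (∏ k ∈ Finset.range n, (Polynomial.X - Polynomial.C (x k))).derivative.eval z =
      (∏ k ∈ Finset.range n, (Polynomial.X - Polynomial.C (x k))).eval z
        * ∑ k ∈ Finset.range n, 1 / (z - x k) := by
  induction n with
  | zero => simp
  | succ n ih =>
    have h1 := ih fun k hk => hz k (by simp at hk ⊢; omega)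
    have h2 := hz n (by simp)
    rw [Finset.prod_range_succ, Finset.sum_range_succ, Polynomial.derivative_mul,
      Polynomial.eval_add, Polynomial.eval_mul, Polynomial.eval_mul, h1]
    simp only [Polynomial.derivative_sub, Polynomial.derivative_X, Polynomial.derivative_C,
      Polynomial.eval_mul, Polynomial.eval_sub, Polynomial.eval_X, Polynomial.eval_C,
      Polynomial.eval_one, sub_zero]
    field_simp

/-- The derivative factors as $Q(z)\,(1+(z-u)g(z))$ with $Q(z)=\prod_k(z-x_k)\ne0$. The point $z=u$
needs no exception: neither side holds there. -/
theorem eval_derivative_pinnedPoly_eq_zero_iff (u : ℂ) (x : ℕ → ℂ) (n : ℕ) (z : ℂ)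
    (hz : ∀ k ∈ Finset.range n, z - x k ≠ 0) :
    (pinnedPoly u x n).derivative.eval z = 0 ↔
      (z - u) * ∑ k ∈ Finset.range n, 1 / (z - x k) = -1 := by
  have hQ : (∏ k ∈ Finset.range n, (Polynomial.X - Polynomial.C (x k))).eval z ≠ 0 := by
    rw [Polynomial.eval_prod, Finset.prod_ne_zero_iff]
    simpa using hz
  rw [pinnedPoly, Polynomial.derivative_mul, Polynomial.eval_add, Polynomial.eval_mul,
    Polynomial.eval_mul, eval_derivative_prod_X_sub_C x n z hz]
  simp only [Polynomial.derivative_sub, Polynomial.derivative_X, Polynomial.derivative_C,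
      Polynomial.eval_sub, Polynomial.eval_X, Polynomial.eval_C,
      Polynomial.eval_one, sub_zero]
  generalize (∏ k ∈ Finset.range n, (Polynomial.X - Polynomial.C (x k))).eval z = q at *
  generalize ∑ k ∈ Finset.range n, 1 / (z - x k) = g
  constructor
  · intro h
    have : q * (1 + (z - u) * g) = 0 := by linear_combination h
    rcases mul_eq_zero.1 this with h | h
    · exact absurd h hQ
    · linear_combination h
  · intro h
    linear_combination q * h

/-- Lipschitz bound for `z ↦ ∑ 1 / (z - x k)` away from its poles. -/
theorem norm_sum_inv_sub_sum_inv_le (u : ℂ) (x : ℕ → ℂ) (n : ℕ) (z w : ℂ) {a b : ℝ}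
    (ha : 0 ≤ a)
    (hpos : ∀ k ∈ Finset.range n, 0 < ‖u - x k‖)
    (hz : ∀ k ∈ Finset.range n, ‖u - x k‖ ≤ a * ‖z - x k‖)
    (hw : ∀ k ∈ Finset.range n, ‖u - x k‖ ≤ b * ‖w - x k‖) :
    ‖∑ k ∈ Finset.range n, 1 / (z - x k) - ∑ k ∈ Finset.range n, 1 / (w - x k)‖ ≤
      a * b * (∑ k ∈ Finset.range n, 1 / ‖u - x k‖ ^ 2) * ‖z - w‖ := by
  rw [← Finset.sum_sub_distrib, Finset.mul_sum, Finset.sum_mul]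
  refine (norm_sum_le _ _).trans (Finset.sum_le_sum fun k hk => ?_)
  have h0 := hpos k hk
  have h1 := hz k hk
  have h2 := hw k hk
  have hz0 : 0 < ‖z - x k‖ := by
    by_contra h
    have : ‖z - x k‖ = 0 := le_antisymm (not_lt.1 h) (norm_nonneg _)
    rw [this] at h1; linarith
  have hw0 : 0 < ‖w - x k‖ := by
    by_contra h
    have : ‖w - x k‖ = 0 := le_antisymm (not_lt.1 h) (norm_nonneg _)
    rw [this] at h2; linarith
  have e : 1 / (z - x k) - 1 / (w - x k) = (w - z) / ((z - x k) * (w - x k)) := by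
    have := norm_pos_iff.1 hz0
    have := norm_pos_iff.1 hw0
    field_simp
    ring
  rw [e, norm_div, norm_mul, norm_sub_rev w z, div_le_iff₀ (by positivity)]
  have h3 : ‖u - x k‖ ^ 2 ≤ a * b * (‖z - x k‖ * ‖w - x k‖) := by
    calc ‖u - x k‖ ^ 2 = ‖u - x k‖ * ‖u - x k‖ := by ring
      _ ≤ (a * ‖z - x k‖) * (b * ‖w - x k‖) := by gcongr
      _ = _ := by ring
  calc ‖z - w‖ = (1 / ‖u - x k‖ ^ 2 * ‖u - x k‖ ^ 2) * ‖z - w‖ := by field_simp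
    _ ≤ (1 / ‖u - x k‖ ^ 2 * (a * b * (‖z - x k‖ * ‖w - x k‖))) * ‖z - w‖ := by gcongr
    _ = _ := by ring

/-- A deterministic criterion for a unique critical point near the pinned zero, with
quantitative information on its position. -/
theorem hasUniqueCriticalPoint_of_bounds (u : ℂ) (x : ℕ → ℂ) (n : ℕ) {r c : ℝ} (hr : 0 < r)
    (hc : 0 < c) (hx : ∀ k ∈ Finset.range n, 2 * r ≤ ‖u - x k‖)
    (hS : c ≤ ‖∑ k ∈ Finset.range n, 1 / (u - x k)‖)
    (hT : 16 * r * (∑ k ∈ Finset.range n, 1 / ‖u - x k‖ ^ 2) ≤ c) (hcr : 2 ≤ c * r) :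
    HasUniqueCriticalPoint (pinnedPoly u x n) u r ∧
      ∀ ζ ∈ Metric.closedBall u r, (pinnedPoly u x n).derivative.eval ζ = 0 →
        ∃ g : ℂ, ‖g - ∑ k ∈ Finset.range n, 1 / (u - x k)‖ ≤
            4 * (∑ k ∈ Finset.range n, 1 / ‖u - x k‖ ^ 2) / c ∧
          c / 2 ≤ ‖g‖ ∧ (ζ - u) * g = -1 := by
  set S : ℂ := ∑ k ∈ Finset.range n, 1 / (u - x k) with hSdef
  set T : ℝ := ∑ k ∈ Finset.range n, 1 / ‖u - x k‖ ^ 2 with hTdef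
  set g : ℂ → ℂ := fun z => ∑ k ∈ Finset.range n, 1 / (z - x k) with hg
  have hT0 : 0 ≤ T := Finset.sum_nonneg fun k _ => by positivity
  have hpos : ∀ k ∈ Finset.range n, 0 < ‖u - x k‖ := fun k hk => by linarith [hx k hk]
  have hball : ∀ z ∈ Metric.closedBall u r, ∀ k ∈ Finset.range n,
      ‖u - x k‖ ≤ 2 * ‖z - x k‖ := by
    intro z hz k hk
    have h1 := hx k hk
    rw [Metric.mem_closedBall, dist_eq_norm] at hz
    have h2 : ‖u - x k‖ ≤ ‖z - u‖ + ‖z - x k‖ := by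
      have := norm_sub_le (z - x k) (z - u)
      simp only [sub_sub_sub_cancel_left] at this
      linarith
    linarith
  have hne : ∀ z ∈ Metric.closedBall u r, ∀ k ∈ Finset.range n, z - x k ≠ 0 := by
    intro z hz k hk h
    have h1 := hball z hz k hk
    rw [h, norm_zero] at h1
    linarith [hpos k hk]
  have hgg : ∀ z ∈ Metric.closedBall u r, ∀ w ∈ Metric.closedBall u r,
      ‖g z - g w‖ ≤ 4 * T * ‖z - w‖ := by
    intro z hz w hw
    have := norm_sum_inv_sub_sum_inv_le u x n z w zero_le_two hpos (hball z hz)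
      (hball w hw)
    calc _ ≤ _ := this
      _ = _ := by ring
  have hgS : ∀ z ∈ Metric.closedBall u r, ‖g z - S‖ ≤ 2 * T * ‖z - u‖ := by
    intro z hz
    -- Comparison with the centre itself loses no factor on that side, hence $2T$ instead of $4T$.
    have := norm_sum_inv_sub_sum_inv_le (b := 1) u x n z u zero_le_two hpos (hball z hz)
      (by simp)
    calc _ ≤ _ := this
      _ = _ := by ring
  have hgl : ∀ z ∈ Metric.closedBall u r, c / 2 ≤ ‖g z‖ := by
    intro z hz
    have h1 := hgS z hz
    rw [Metric.mem_closedBall, dist_eq_norm] at hz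
    have h2 : 2 * T * ‖z - u‖ ≤ 2 * T * r := by gcongr
    have h3 : ‖S‖ ≤ ‖g z‖ + ‖g z - S‖ := by
      have := norm_sub_le (g z) (g z - S)
      simpa using this
    nlinarith
  have hgne : ∀ z ∈ Metric.closedBall u r, g z ≠ 0 := by
    intro z hz h
    have := hgl z hz
    rw [h, norm_zero] at this
    linarith
  have hcrit : ∀ z ∈ Metric.closedBall u r,
      ((pinnedPoly u x n).derivative.eval z = 0 ↔ (z - u) * g z = -1) := fun z hz =>
    eval_derivative_pinnedPoly_eq_zero_iff u x n z (hne z hz)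
  -- Eliminate $r$: $32T\le16T\cdot cr\le c^2$. Together with $|g|\ge c/2$ this makes the Lipschitz
  -- constant $4T/(c/2)^2$ of `F` at most $1/2$.
  have hT2 : 32 * T ≤ c ^ 2 := by
    have : 16 * T * 2 ≤ 16 * T * (c * r) := by gcongr
    nlinarith
  set F : ℂ → ℂ := fun z => u - 1 / g z with hF
  have hmaps : Set.MapsTo F (Metric.closedBall u r) (Metric.closedBall u r) := by
    intro z hz
    rw [Metric.mem_closedBall, dist_eq_norm]
    have h1 := hgl z hz
    have : ‖F z - u‖ = 1 / ‖g z‖ := by simp [hF]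
    rw [this, div_le_iff₀ (by linarith)]
    nlinarith
  have hlip : ∀ z ∈ Metric.closedBall u r, ∀ w ∈ Metric.closedBall u r,
      ‖F z - F w‖ ≤ 1 / 2 * ‖z - w‖ := by
    intro z hz w hw
    have h1 := hgl z hz
    have h2 := hgl w hw
    have e : F z - F w = (g z - g w) / (g z * g w) := by
      have := hgne z hz
      have := hgne w hw
      simp only [hF]
      field_simp
      ring
    rw [e, norm_div, norm_mul, div_le_iff₀ (mul_pos (by linarith) (by linarith))]
    have h3 : c / 2 * (c / 2) ≤ ‖g z‖ * ‖g w‖ := by gcongr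
    have h4 : 4 * T ≤ 1 / 2 * (‖g z‖ * ‖g w‖) := by nlinarith
    calc _ ≤ _ := hgg z hz w hw
      _ ≤ (1 / 2 * (‖g z‖ * ‖g w‖)) * ‖z - w‖ := by gcongr
      _ = _ := by ring
  have hfix : ∀ z ∈ Metric.closedBall u r, ((z - u) * g z = -1 ↔ F z = z) := by
    intro z hz
    have := hgne z hz
    simp only [hF]
    constructor
    · intro h
      field_simp
      linear_combination -h
    · intro h
      field_simp at h
      linear_combination -h
  have hcontr : ContractingWith (1 / 2 : ℝ≥0) (hmaps.restrict F _ _) := by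
    refine ⟨by norm_num, LipschitzWith.of_dist_le_mul fun z w => ?_⟩
    rw [Subtype.dist_eq, Subtype.dist_eq, dist_eq_norm, dist_eq_norm]
    simpa using hlip z z.2 w w.2
  obtain ⟨ζ, hζ, hζF, -⟩ := ContractingWith.exists_fixedPoint'
    (Metric.isClosed_closedBall (x := u) (ε := r)).isComplete hmaps hcontr
    (Metric.mem_closedBall_self hr.le) (edist_ne_top _ _)
  refine ⟨⟨ζ, ⟨hζ, (hcrit ζ hζ).2 ((hfix ζ hζ).2 hζF)⟩, ?_⟩, ?_⟩
  · rintro w ⟨hw, hw0⟩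
    have hwF := (hfix w hw).1 ((hcrit w hw).1 hw0)
    have h := hlip w hw ζ hζ
    rw [hwF, hζF.eq] at h
    have : ‖w - ζ‖ = 0 := by linarith [norm_nonneg (w - ζ)]
    exact sub_eq_zero.1 (norm_eq_zero.1 this)
  · intro w hw hw0
    have h1 := (hcrit w hw).1 hw0
    have h2 := hgl w hw
    refine ⟨g w, ?_, h2, h1⟩
    have h3 : ‖w - u‖ * ‖g w‖ = 1 := by rw [← norm_mul, h1]; simp
    -- The equation $(w-u)g(w)=-1$ improves the a priori bound $r$ to $2/c$, so the error bound on
    -- $g-S$ is free of $r$.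
    have h4 : ‖w - u‖ ≤ 2 / c := by
      rw [le_div_iff₀ hc]
      nlinarith [norm_nonneg (w - u)]
    calc _ ≤ _ := hgS w hw
      _ ≤ 2 * T * (2 / c) := by gcongr
      _ = _ := by ring

/-! ### Measurability of the critical point -/

/-- If `C` is compact and `G` is continuous, the set of parameters for which `G x` has a zero
in `C` is closed. -/
theorem isClosed_setOf_exists_zero {X Z E : Type*} [TopologicalSpace X] [TopologicalSpace Z]
    [TopologicalSpace E] [Zero E] [T1Space E] {G : X → Z → E} (hG : Continuous fun q : X × Z => G q.1 q.2) {C : Set Z} (hC : IsCompact C) :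
    IsClosed {x | ∃ z ∈ C, G x z = 0} := by
  have h : {x | ∃ z ∈ C, G x z = 0} =
      Prod.snd '' (((fun q : C × X => G q.2 q.1.1) ⁻¹' {0})) := by
    ext x
    simp
  rw [h]
  have : CompactSpace C := isCompact_iff_compactSpace.1 hC
  refine isClosedMap_snd_of_compactSpace _ (isClosed_singleton.preimage ?_)
  exact hG.comp (by fun_prop : Continuous fun q : C × X => (q.2, (q.1 : Z)))

/-- Existence of a zero is a closed condition. Its non-uniqueness is a countable union of closed
conditions, namely two zeros at distance at least $1/(m+1)$: such pairs range over a compact set. -/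
theorem measurableSet_existsUnique_zero {X : Type*} [TopologicalSpace X]
    [MeasurableSpace X] [BorelSpace X] {G : X → ℂ → ℂ}
    (hG : Continuous fun q : X × ℂ => G q.1 q.2) {K : Set ℂ} (hK : IsCompact K) :
    MeasurableSet {x | ∃! z, z ∈ K ∧ G x z = 0} := by
  have h : {x | ∃! z, z ∈ K ∧ G x z = 0} = {x | ∃ z ∈ K, G x z = 0} \
      ⋃ m : ℕ, {x | ∃ q ∈ (K ×ˢ K) ∩ {q : ℂ × ℂ | 1 / ((m : ℝ) + 1) ≤ dist q.1 q.2},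
        (G x q.1, G x q.2) = 0} := by
    ext x
    simp only [Set.mem_ofPred_eq, Set.mem_sdiff, Set.mem_iUnion, not_exists]
    constructor
    · rintro ⟨z, ⟨hz, hz0⟩, hu⟩
      refine ⟨⟨z, hz, hz0⟩, ?_⟩
      rintro m ⟨z₁, z₂⟩ ⟨⟨⟨h1, h2⟩, hd⟩, h0⟩
      obtain ⟨e1, e2⟩ := Prod.mk.inj h0
      have e3 : z₁ = z₂ := (hu z₁ ⟨h1, e1⟩).trans (hu z₂ ⟨h2, e2⟩).symm
      simp only [Set.mem_ofPred_eq, e3, dist_self] at hd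
      have : (0 : ℝ) < 1 / ((m : ℝ) + 1) := by positivity
      linarith
    · rintro ⟨⟨z, hz, hz0⟩, hn⟩
      refine ⟨z, ⟨hz, hz0⟩, ?_⟩
      rintro w ⟨hw, hw0⟩
      by_contra hne
      obtain ⟨m, hm⟩ := exists_nat_one_div_lt (dist_pos.2 hne)
      exact hn m (w, z) ⟨⟨⟨hw, hz⟩, hm.le⟩, by simp [hw0, hz0]⟩
  rw [h]
  refine (isClosed_setOf_exists_zero hG hK).measurableSet.diff
    (MeasurableSet.iUnion fun m => IsClosed.measurableSet ?_)
  refine isClosed_setOf_exists_zero (G := fun x (q : ℂ × ℂ) => (G x q.1, G x q.2)) ?_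
    ((hK.prod hK).inter_right (isClosed_le (by fun_prop) (by fun_prop)))
  have h1 := hG.comp (by fun_prop : Continuous fun q : X × (ℂ × ℂ) => (q.1, q.2.1))
  have h2 := hG.comp (by fun_prop : Continuous fun q : X × (ℂ × ℂ) => (q.1, q.2.2))
  exact h1.prodMk h2

/-- A map which picks the unique zero in a compact set, where there is one, and `0` elsewhere, is
measurable. -/
theorem measurable_of_unique_zero {X : Type*} [TopologicalSpace X]
    [MeasurableSpace X] [BorelSpace X] {G : X → ℂ → ℂ}
    (hG : Continuous fun q : X × ℂ => G q.1 q.2) {K : Set ℂ} (hK : IsCompact K) {Z : X → ℂ}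
    (hZ : ∀ x, (∃! z, z ∈ K ∧ G x z = 0) → Z x ∈ K ∧ G x (Z x) = 0)
    (hZ0 : ∀ x, (¬ ∃! z, z ∈ K ∧ G x z = 0) → Z x = 0) : Measurable Z := by
  have hU := measurableSet_existsUnique_zero hG hK
  refine measurable_of_isClosed fun C hC => ?_
  -- By uniqueness, the selected zero lies in $C$ iff some zero lies in $K\cap C$, which is again a
  -- closed condition on $x$.
  have h : Z ⁻¹' C = ({x | ∃! z, z ∈ K ∧ G x z = 0} ∩ {x | ∃ z ∈ K ∩ C, G x z = 0}) ∪
      ({x | ∃! z, z ∈ K ∧ G x z = 0}ᶜ ∩ {_x | (0 : ℂ) ∈ C}) := by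
    ext x
    by_cases hx : ∃! z, z ∈ K ∧ G x z = 0
    · have h1 := hZ x hx
      have : Z x ∈ C ↔ ∃ z ∈ K ∩ C, G x z = 0 := by
        constructor
        · exact fun h => ⟨Z x, ⟨h1.1, h⟩, h1.2⟩
        · rintro ⟨z, ⟨hzK, hzC⟩, hz⟩
          rwa [hx.unique h1 ⟨hzK, hz⟩]
      simp only [Set.mem_preimage, this, Set.mem_union, Set.mem_inter_iff, Set.mem_ofPred_eq, hx,
        Set.mem_compl_iff, true_and, not_true_eq_false, false_and, or_false]
    · have h1 := hZ0 x hx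
      simp only [Set.mem_preimage, Set.mem_union, Set.mem_inter_iff, Set.mem_ofPred_eq, hx,
        Set.mem_compl_iff, not_false_eq_true, true_and, false_and, h1, false_or]
  rw [h]
  exact (hU.inter (isClosed_setOf_exists_zero hG (hK.inter_right hC)).measurableSet).union
    (hU.compl.inter (MeasurableSet.const _))

theorem continuous_eval_derivative_pinnedPoly (u : ℂ) (n : ℕ) :
    Continuous fun q : (ℕ → ℂ) × ℂ => (pinnedPoly u q.1 n).derivative.eval q.2 := by
  have h : ∀ q : (ℕ → ℂ) × ℂ, (pinnedPoly u q.1 n).derivative.eval q.2 =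
      ∏ k ∈ Finset.range n, (q.2 - q.1 k) + (q.2 - u) *
        ∑ i ∈ Finset.range n, ∏ k ∈ (Finset.range n).erase i, (q.2 - q.1 k) := by
    intro q
    simp [pinnedPoly, Polynomial.derivative_mul, Polynomial.derivative_prod_finset,
      Polynomial.eval_prod, Polynomial.eval_finsetSum]
  simp_rw [h]
  fun_prop

theorem measurableSet_hasUniqueCriticalPoint (u : ℂ) (n : ℕ) (r : ℝ) :
    MeasurableSet {x : ℕ → ℂ | HasUniqueCriticalPoint (pinnedPoly u x n) u r} :=
  measurableSet_existsUnique_zero (continuous_eval_derivative_pinnedPoly u n)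
    (isCompact_closedBall u r)

theorem criticalPointOr_spec {P : Polynomial ℂ} {u : ℂ} {r : ℝ} (a : ℂ)
    (h : HasUniqueCriticalPoint P u r) :
    criticalPointOr P u r a ∈ Metric.closedBall u r ∧
      P.derivative.eval (criticalPointOr P u r a) = 0 := by
  rw [criticalPointOr, dif_pos h]
  exact h.exists.choose_spec

/-- The fallback value need not be a function of the sample. The selection with fallback $0$ is
therefore measurable on sequence space first, and `a` is glued in as a second coordinate. -/
theorem aemeasurable_criticalPointOr {Ω : Type*} [MeasurableSpace Ω] {μ : Measure Ω}
    {ξ : ℕ → Ω → ℂ} (hξ : ∀ k, AEMeasurable (ξ k) μ) {a : Ω → ℂ} (ha : AEMeasurable a μ)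
    (u : ℂ) (n : ℕ) (r : ℝ) :
    AEMeasurable (fun ω => criticalPointOr (pinnedPoly u (fun k => ξ k ω) n) u r (a ω)) μ := by
  classical
  set U := {x : ℕ → ℂ | HasUniqueCriticalPoint (pinnedPoly u x n) u r} with hUdef
  have hU : MeasurableSet U := measurableSet_hasUniqueCriticalPoint u n r
  have hZ : Measurable fun x : ℕ → ℂ => criticalPointOr (pinnedPoly u x n) u r 0 :=
    measurable_of_unique_zero (continuous_eval_derivative_pinnedPoly u n)
      (isCompact_closedBall u r) (fun x hx => criticalPointOr_spec 0 hx)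
      (fun x hx => dif_neg hx)
  have hξ' : AEMeasurable (fun ω k => ξ k ω) μ := aemeasurable_pi_lambda _ hξ
  have hF : Measurable fun q : (ℕ → ℂ) × ℂ =>
      if q.1 ∈ U then criticalPointOr (pinnedPoly u q.1 n) u r 0 else q.2 :=
    Measurable.ite (measurable_fst hU) (hZ.comp measurable_fst) measurable_snd
  have := hF.comp_aemeasurable (hξ'.prodMk ha)
  refine this.congr (ae_of_all _ fun ω => ?_)
  by_cases h : HasUniqueCriticalPoint (pinnedPoly u (fun k => ξ k ω) n) u r
  · simp [hUdef, h, criticalPointOr]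
  · simp [hUdef, h, criticalPointOr]

/-! ### Planar integrals of inverse powers -/

/-- Integral of `‖w‖⁻²` over an annulus. -/
theorem setIntegral_annulus_inv_sq {a η : ℝ} (ha : 0 < a) (h : a ≤ η) :
    ∫ w in Metric.closedBall (0 : ℂ) η \ Metric.ball 0 a, 1 / ‖w‖ ^ 2 =
      2 * Real.pi * Real.log (η / a) := by
  rw [← integral_indicator (measurableSet_closedBall.diff measurableSet_ball)]
  have e : ((Metric.closedBall (0 : ℂ) η \ Metric.ball 0 a).indicator fun w => 1 / ‖w‖ ^ 2) =
      fun w : ℂ => ((Set.Icc a η).indicator fun y : ℝ => 1 / y ^ 2) ‖w‖ := by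
    ext w
    simp [Set.indicator, and_comm]
  rw [e, integral_fun_norm_addHaar]
  -- The polar Jacobian $y$ cancels one power and leaves $1/y$, the source of the logarithm.
  have e2 : ∀ y : ℝ, y ^ (Module.finrank ℝ ℂ - 1) • (Set.Icc a η).indicator
      (fun y : ℝ => 1 / y ^ 2) y = (Set.Icc a η).indicator (fun y : ℝ => 1 / y) y := by
    intro y
    by_cases hy : y ∈ Set.Icc a η
    · have : y ≠ 0 := ne_of_gt (ha.trans_le hy.1)
      rw [Set.indicator_of_mem hy, Set.indicator_of_mem hy, Complex.finrank_real_complex]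
      simp
      field_simp
    · rw [Set.indicator_of_notMem hy, Set.indicator_of_notMem hy, smul_zero]
  have e3 : Set.Ioi 0 ∩ Set.Icc a η = Set.Icc a η :=
    Set.inter_eq_self_of_subset_right fun y hy => ha.trans_le hy.1
  simp_rw [e2]
  rw [setIntegral_indicator measurableSet_Icc, e3, integral_Icc_eq_integral_Ioc,
    ← intervalIntegral.integral_of_le h, integral_one_div_of_pos ha (ha.trans_le h)]
  simp [Measure.real, Complex.finrank_real_complex, Complex.volume_ball]
  ring

theorem integrableOn_ball_inv_norm (ρ : ℝ) :
    IntegrableOn (fun w : ℂ => 1 / ‖w‖) (Metric.ball 0 ρ) := by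
  refine (integrableOn_fun_norm_addHaar volume (f := fun y : ℝ => 1 / y)).2 ?_
  refine (integrableOn_const (C := (1 : ℝ)) (by simp)).congr_fun (fun y hy => ?_) measurableSet_Ioo
  have : y ≠ 0 := hy.1.ne'
  simp [Complex.finrank_real_complex, this]

/-- Integral of `‖w‖⁻¹` over a disk. -/
theorem setIntegral_ball_inv_norm {ρ : ℝ} (hρ : 0 ≤ ρ) :
    ∫ w in Metric.ball (0 : ℂ) ρ, 1 / ‖w‖ = 2 * Real.pi * ρ := by
  rw [← integral_indicator measurableSet_ball]
  have e : ((Metric.ball (0 : ℂ) ρ).indicator fun w => 1 / ‖w‖) =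
      fun w : ℂ => ((Set.Iio ρ).indicator fun y : ℝ => 1 / y) ‖w‖ := by
    ext w
    simp [Set.indicator]
  rw [e, integral_fun_norm_addHaar]
  have e2 : Set.EqOn (fun y : ℝ => y ^ (Module.finrank ℝ ℂ - 1) • (Set.Iio ρ).indicator
      (fun y : ℝ => 1 / y) y) ((Set.Iio ρ).indicator (fun _ : ℝ => 1)) (Set.Ioi 0) := by
    intro y hy
    have : y ≠ 0 := ne_of_gt hy
    by_cases hy : y ∈ Set.Iio ρ
    · simp only [Set.indicator_of_mem hy, Complex.finrank_real_complex]
      simp [this]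
    · simp only [Set.indicator_of_notMem hy, smul_zero]
  rw [setIntegral_congr_fun measurableSet_Ioi e2, setIntegral_indicator measurableSet_Iio,
    Set.Ioi_inter_Iio]
  simp [Measure.real, Complex.finrank_real_complex, Complex.volume_ball, hρ]
  ring

/-- Replacing $w$ by $iw$ turns $1/w$ through a right angle, so this is Pythagoras for $t$ in an
orthogonal frame. -/
theorem inner_inv_sq_add_inner_inv_I_mul_sq (w t : ℂ) :
    (inner ℝ (1 / w) t : ℝ) ^ 2 + (inner ℝ (1 / (Complex.I * w)) t : ℝ) ^ 2 =
      ‖t‖ ^ 2 * (1 / ‖w‖ ^ 2) := by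
  have e : (1 : ℂ) / (Complex.I * w) = -Complex.I * (1 / w) := by
    rw [one_div, mul_inv, Complex.inv_I, one_div]
  have e2 : 1 / ‖w‖ ^ 2 = ‖1 / w‖ ^ 2 := by simp
  rw [e, e2]
  generalize 1 / w = y
  simp only [Complex.inner, Complex.sq_norm, Complex.normSq_apply]
  simp
  ring

/-- The integral over an annulus of the squared real linear functional of `1 / w`. -/
theorem setIntegral_annulus_inner_sq (t : ℂ) {a η : ℝ} (ha : 0 < a) (h : a ≤ η) :
    ∫ w in Metric.closedBall (0 : ℂ) η \ Metric.ball 0 a, (inner ℝ (1 / w) t : ℝ) ^ 2 =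
      Real.pi * ‖t‖ ^ 2 * Real.log (η / a) := by
  set A := Metric.closedBall (0 : ℂ) η \ Metric.ball 0 a with hA
  have hm : MeasurableSet A := measurableSet_closedBall.diff measurableSet_ball
  have hAfin : volume A ≠ ∞ := ne_top_of_le_ne_top
    (measure_closedBall_lt_top (x := (0 : ℂ)) (r := η)).ne (measure_mono Set.sdiff_subset)
  have hAmem : ∀ w ∈ A, a ≤ ‖w‖ := fun w hw => by simpa using hw.2
  -- This rotation preserves the annulus and Lebesgue measure, so the two squares have equal
  -- integrals, each half of the integral of $|t|^2/|w|^2$.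
  let R : ℂ ≃ₗᵢ[ℝ] ℂ := rotation ⟨Complex.I, by simp [Submonoid.unitSphere]⟩
  have hR : ∀ w, R w = Complex.I * w := fun w => rfl
  have hRA : R ⁻¹' A = A := by
    ext w
    simp [hA]
  have hint : ∀ c : ℂ, ‖c‖ = 1 →
      IntegrableOn (fun w : ℂ => (inner ℝ (1 / (c * w)) t : ℝ) ^ 2) A := by
    intro c hc
    refine IntegrableOn.of_bound hAfin.lt_top
      (Measurable.aestronglyMeasurable (by fun_prop)) ((1 / a * ‖t‖) ^ 2) ?_
    refine (ae_restrict_iff' hm).2 (ae_of_all _ fun w hw => ?_)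
    rw [norm_pow, Real.norm_eq_abs]
    gcongr
    refine (abs_real_inner_le_norm _ _).trans ?_
    rw [norm_div, norm_one, norm_mul, hc, one_mul]
    gcongr
    exact hAmem w hw
  have hrot : ∫ w in A, (inner ℝ (1 / (Complex.I * w)) t : ℝ) ^ 2 =
      ∫ w in A, (inner ℝ (1 / w) t : ℝ) ^ 2 := by
    have := R.measurePreserving.setIntegral_preimage_emb R.toHomeomorph.measurableEmbedding
      (fun w : ℂ => (inner ℝ (1 / w) t : ℝ) ^ 2) A
    rw [hRA] at this
    exact this
  have hint1 := hint 1 (by simp)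
  simp_rw [one_mul] at hint1
  have hsum := integral_add hint1 (hint Complex.I (by simp))
  simp_rw [inner_inv_sq_add_inner_inv_I_mul_sq] at hsum
  rw [integral_const_mul, setIntegral_annulus_inv_sq ha h, hrot] at hsum
  linarith

/-! ### Moments of $1/(u-x)$ from the local density -/

/-- Near a point of continuity of its density, a measure is close to a multiple of Lebesgue
measure. -/
theorem HasLebesgueDensityOn.exists_restrict_le {ν : Measure ℂ} {p : ℂ → ℝ} {u : ℂ} {δ : ℝ}
    (hδ : 0 < δ) (h : HasLebesgueDensityOn ν p (Metric.closedBall u δ)) (hp : ContinuousAt p u)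
    {ε : ℝ} (hε : 0 < ε) :
    ∃ η > 0, ν.restrict (Metric.closedBall u η) ≤
        ENNReal.ofReal (p u + ε) • volume.restrict (Metric.closedBall u η) ∧
      ENNReal.ofReal (p u - ε) • volume.restrict (Metric.closedBall u η) ≤
        ν.restrict (Metric.closedBall u η) := by
  obtain ⟨η₁, hη₁, H⟩ := Metric.continuousAt_iff.1 hp ε hε
  have hη : 0 < min (η₁ / 2) δ := lt_min (by linarith) hδ
  refine ⟨min (η₁ / 2) δ, hη, ?_⟩
  set B := Metric.closedBall u (min (η₁ / 2) δ)
  have hB : MeasurableSet B := measurableSet_closedBall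
  have hBs : B ⊆ Metric.closedBall u δ := Metric.closedBall_subset_closedBall (min_le_right _ _)
  have hpB : ∀ z ∈ B, |p z - p u| < ε := by
    intro z hz
    refine H ?_
    rw [Metric.mem_closedBall] at hz
    linarith [min_le_left (η₁ / 2) δ]
  constructor
  · refine Measure.le_iff.2 fun A hA => ?_
    rw [Measure.restrict_apply hA, Measure.smul_apply, Measure.restrict_apply hA,
      h.2.2 _ (hA.inter hB) (Set.inter_subset_right.trans hBs), smul_eq_mul, ← setLIntegral_const]
    refine setLIntegral_mono' (hA.inter hB) fun z hz => ENNReal.ofReal_le_ofReal ?_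
    linarith [(abs_lt.1 (hpB z hz.2)).2]
  · refine Measure.le_iff.2 fun A hA => ?_
    rw [Measure.restrict_apply hA, Measure.smul_apply, Measure.restrict_apply hA,
      h.2.2 _ (hA.inter hB) (Set.inter_subset_right.trans hBs), smul_eq_mul, ← setLIntegral_const]
    refine setLIntegral_mono' (hA.inter hB) fun z hz => ENNReal.ofReal_le_ofReal ?_
    linarith [(abs_lt.1 (hpB z hz.2)).1]

theorem HasLebesgueDensityOn.nonneg_center {ν : Measure ℂ} {p : ℂ → ℝ} {u : ℂ} {δ : ℝ}
    (hδ : 0 < δ) (h : HasLebesgueDensityOn ν p (Metric.closedBall u δ)) : 0 ≤ p u :=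
  h.2.1 u (Metric.mem_closedBall_self hδ.le)

/-- Small disks around `u` have mass of the order of their area. -/
theorem HasLebesgueDensityOn.exists_measure_closedBall_le {ν : Measure ℂ} {p : ℂ → ℝ} {u : ℂ}
    {δ : ℝ} (hδ : 0 < δ) (h : HasLebesgueDensityOn ν p (Metric.closedBall u δ))
    (hp : ContinuousAt p u) :
    ∃ C η : ℝ, 0 < η ∧ 0 ≤ C ∧ ∀ ρ, 0 ≤ ρ → ρ ≤ η →
      ν (Metric.closedBall u ρ) ≤ ENNReal.ofReal (C * ρ ^ 2) := by
  obtain ⟨η, hη, H, -⟩ := h.exists_restrict_le hδ hp one_pos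
  have h0 := h.nonneg_center hδ
  refine ⟨(p u + 1) * Real.pi, η, hη, by positivity, fun ρ hρ hρη => ?_⟩
  have := H (Metric.closedBall u ρ)
  rw [Measure.smul_apply, Measure.restrict_apply measurableSet_closedBall,
    Measure.restrict_apply measurableSet_closedBall,
    Set.inter_eq_self_of_subset_left (Metric.closedBall_subset_closedBall hρη),
    Complex.volume_closedBall, smul_eq_mul] at this
  refine this.trans (le_of_eq ?_)
  rw [mul_assoc, ENNReal.ofReal_mul (by linarith), ENNReal.ofReal_mul Real.pi_pos.le,
    ENNReal.ofReal_pow hρ, mul_comm (ENNReal.ofReal Real.pi)]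
  congr 2
  rw [← NNReal.coe_real_pi, ENNReal.ofReal_coe_nnreal]

/-- The tail of the first absolute moment of `1 / (u - x)`. -/
theorem HasLebesgueDensityOn.exists_tail_integral_le {ν : Measure ℂ} {p : ℂ → ℝ} {u : ℂ}
    {δ : ℝ} (hδ : 0 < δ) (h : HasLebesgueDensityOn ν p (Metric.closedBall u δ))
    (hp : ContinuousAt p u) :
    ∃ C : ℝ, 0 ≤ C ∧ ∀ᶠ b in atTop,
      ∫ y in (Metric.closedBall 0 b)ᶜ, ‖y‖ ∂(ν.map fun x => 1 / (u - x)) ≤ C / b := by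
  obtain ⟨η, hη, H, -⟩ := h.exists_restrict_le hδ hp one_pos
  have h0 := h.nonneg_center hδ
  refine ⟨(p u + 1) * (2 * Real.pi), by positivity, ?_⟩
  filter_upwards [eventually_gt_atTop 0, eventually_ge_atTop (1 / η)] with b hb hbη
  have hbη' : 1 / b ≤ η := by
    rw [div_le_iff₀ hη] at hbη
    rw [div_le_iff₀ hb]; linarith
  rw [setIntegral_map measurableSet_closedBall.compl (by fun_prop) (by fun_prop)]
  have hmp : MeasurePreserving (fun x : ℂ => u - x) volume volume :=
    Measure.measurePreserving_sub_left volume u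
  have hemb : MeasurableEmbedding (fun x : ℂ => u - x) :=
    (Homeomorph.subLeft u).measurableEmbedding
  have hpre : (fun x : ℂ => u - x) ⁻¹' Metric.ball 0 (1 / b) = Metric.ball u (1 / b) := by
    ext x; simp [dist_eq_norm, norm_sub_rev]
  have hvol := hmp.setIntegral_preimage_emb hemb (fun w : ℂ => 1 / ‖w‖) (Metric.ball 0 (1 / b))
  have hvoli := (hmp.integrableOn_comp_preimage hemb).2 (integrableOn_ball_inv_norm (1 / b))
  rw [hpre] at hvol hvoli
  rw [setIntegral_ball_inv_norm (by positivity)] at hvol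
  have hle : ν.restrict (Metric.ball u (1 / b)) ≤
      ENNReal.ofReal (p u + 1) • volume.restrict (Metric.ball u (1 / b)) := by
    have hsub : Metric.ball u (1 / b) ∩ Metric.closedBall u η = Metric.ball u (1 / b) :=
      Set.inter_eq_self_of_subset_left
        ((Metric.ball_subset_ball hbη').trans Metric.ball_subset_closedBall)
    have := Measure.restrict_mono_measure H (Metric.ball u (1 / b))
    rwa [Measure.restrict_smul, Measure.restrict_restrict measurableSet_ball,
      Measure.restrict_restrict measurableSet_ball, hsub] at this
  have hsm : Integrable (fun x : ℂ => 1 / ‖u - x‖)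
      (ENNReal.ofReal (p u + 1) • volume.restrict (Metric.ball u (1 / b))) :=
    Integrable.smul_measure hvoli ENNReal.ofReal_ne_top
  calc ∫ x in (fun x => 1 / (u - x)) ⁻¹' (Metric.closedBall 0 b)ᶜ, ‖1 / (u - x)‖ ∂ν
      ≤ ∫ x in Metric.ball u (1 / b), 1 / ‖u - x‖ ∂ν := by
        simp_rw [norm_div, norm_one]
        refine setIntegral_mono_set (hsm.mono_measure hle) (ae_of_all _ fun x => by positivity)
          (Eventually.of_forall fun x hx => ?_)
        replace hx : x ∈ (fun x => 1 / (u - x)) ⁻¹' (Metric.closedBall 0 b)ᶜ := hx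
        have hx' : b < ‖u - x‖⁻¹ := by simpa using hx
        -- The point $x=u$ is not in the tail set, since there $1/0=0$.
        have hpos : 0 < ‖u - x‖ := by
          by_contra hcon
          have : ‖u - x‖ = 0 := le_antisymm (not_lt.1 hcon) (norm_nonneg _)
          rw [this, inv_zero] at hx'; linarith
        change x ∈ Metric.ball u (1 / b)
        rw [Metric.mem_ball, dist_comm, dist_eq_norm, lt_div_iff₀ hb]
        have := mul_lt_mul_of_pos_left hx' hpos
        rwa [mul_inv_cancel₀ hpos.ne'] at this
    _ ≤ ∫ x, 1 / ‖u - x‖ ∂(ENNReal.ofReal (p u + 1) • volume.restrict (Metric.ball u (1 / b))) :=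
        integral_mono_measure hle (ae_of_all _ fun x => by positivity) hsm
    _ = (p u + 1) * (2 * Real.pi) / b := by
        rw [integral_smul_measure, hvol, ENNReal.toReal_ofReal (by linarith), smul_eq_mul]
        ring

theorem integrableOn_inner_sq_closedBall (κ : Measure ℂ) [IsFiniteMeasure κ] (t : ℂ) (b : ℝ) :
    IntegrableOn (fun y : ℂ => (inner ℝ y t : ℝ) ^ 2) (Metric.closedBall 0 b) κ := by
  refine IntegrableOn.of_bound (measure_lt_top _ _)
    (Measurable.aestronglyMeasurable (by fun_prop)) ((b * ‖t‖) ^ 2) ?_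
  refine (ae_restrict_iff' measurableSet_closedBall).2 (ae_of_all _ fun y hy => ?_)
  rw [mem_closedBall_zero_iff] at hy
  rw [norm_pow, Real.norm_eq_abs]
  gcongr
  exact (abs_real_inner_le_norm _ _).trans (by gcongr)

/-- Two-sided bound for the truncated second moment of `1 / (u - x)` in the direction `t`. -/
theorem HasLebesgueDensityOn.exists_truncated_second_moment_bounds {ν : Measure ℂ}
    [IsProbabilityMeasure ν] {p : ℂ → ℝ} {u : ℂ}
    {δ : ℝ} (hδ : 0 < δ) (h : HasLebesgueDensityOn ν p (Metric.closedBall u δ))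
    (hp : ContinuousAt p u) (t : ℂ) {ε : ℝ} (hε : 0 < ε) :
    ∃ C : ℝ, ∀ᶠ b in atTop,
      |∫ y in Metric.closedBall 0 b, (inner ℝ y t : ℝ) ^ 2 ∂(ν.map fun x => 1 / (u - x)) -
        Real.pi * p u * ‖t‖ ^ 2 * Real.log b| ≤ ε * (Real.pi * ‖t‖ ^ 2) * Real.log b + C := by
  obtain ⟨η, hη, H1, H2⟩ := h.exists_restrict_le hδ hp hε
  have h0 := h.nonneg_center hδ
  have hYm : Measurable fun x : ℂ => 1 / (u - x) := by fun_prop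
  have : IsProbabilityMeasure (ν.map fun x => 1 / (u - x)) :=
    Measure.isProbabilityMeasure_map hYm.aemeasurable
  -- The first term absorbs $\log\eta$ from the annulus $1/b\le|u-x|\le\eta$; the second bounds the
  -- integrand where $|u-x|>\eta$.
  refine ⟨(p u + ε) * (Real.pi * ‖t‖ ^ 2) * |Real.log η| + ‖t‖ ^ 2 / η ^ 2, ?_⟩
  filter_upwards [eventually_gt_atTop 0, eventually_ge_atTop (1 / η), eventually_ge_atTop 1]
    with b hb hbη hb1
  have hbη' : 1 / b ≤ η := by
    rw [div_le_iff₀ hη] at hbη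
    rw [div_le_iff₀ hb]; linarith
  have hint := integrableOn_inner_sq_closedBall (ν.map fun x => 1 / (u - x)) t b
  rw [setIntegral_map measurableSet_closedBall (by fun_prop) (by fun_prop)]
  set E : Set ℂ := (fun x => 1 / (u - x)) ⁻¹' Metric.closedBall 0 b with hE
  have hEm : MeasurableSet E := hYm measurableSet_closedBall
  set B := Metric.closedBall u η with hB
  have hBm : MeasurableSet B := measurableSet_closedBall
  have hEb : ∀ x ∈ E, ‖1 / (u - x)‖ ≤ b := fun x hx => by
    have : 1 / (u - x) ∈ Metric.closedBall 0 b := hx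
    rwa [mem_closedBall_zero_iff] at this
  have hbound : ∀ (ρ : Measure ℂ), ρ (E ∩ B) < ∞ →
      IntegrableOn (fun x : ℂ => (inner ℝ (1 / (u - x)) t : ℝ) ^ 2) (E ∩ B) ρ := by
    intro ρ hρ
    refine IntegrableOn.of_bound hρ
      (Measurable.aestronglyMeasurable (by fun_prop)) ((b * ‖t‖) ^ 2) ?_
    refine (ae_restrict_iff' (hEm.inter hBm)).2 (ae_of_all _ fun x hx => ?_)
    rw [norm_pow, Real.norm_eq_abs]
    gcongr
    exact (abs_real_inner_le_norm _ _).trans (by gcongr; exact hEb x hx.1)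
  have hνint : IntegrableOn (fun x : ℂ => (inner ℝ (1 / (u - x)) t : ℝ) ^ 2) E ν := by
    refine IntegrableOn.of_bound (measure_lt_top _ _)
      (Measurable.aestronglyMeasurable (by fun_prop)) ((b * ‖t‖) ^ 2) ?_
    refine (ae_restrict_iff' hEm).2 (ae_of_all _ fun x hx => ?_)
    rw [norm_pow, Real.norm_eq_abs]
    gcongr
    exact (abs_real_inner_le_norm _ _).trans (by gcongr; exact hEb x hx)
  -- the Lebesgue integral over the part near `u`
  have hvolfin : volume (E ∩ B) < ∞ :=
    (measure_mono Set.inter_subset_right).trans_lt measure_closedBall_lt_top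
  have hvol : ∫ x in E ∩ B, (inner ℝ (1 / (u - x)) t : ℝ) ^ 2 =
      Real.pi * ‖t‖ ^ 2 * (Real.log b + Real.log η) := by
    have hmp : MeasurePreserving (fun x : ℂ => u - x) volume volume :=
      Measure.measurePreserving_sub_left volume u
    have hemb : MeasurableEmbedding (fun x : ℂ => u - x) :=
      (Homeomorph.subLeft u).measurableEmbedding
    have hpre : (fun x : ℂ => u - x) ⁻¹'
        ((fun w : ℂ => 1 / w) ⁻¹' Metric.closedBall 0 b ∩ Metric.closedBall 0 η) = E ∩ B := by
      ext x; simp [hE, hB, dist_eq_norm, norm_sub_rev]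
    have h1 := hmp.setIntegral_preimage_emb hemb (fun w : ℂ => (inner ℝ (1 / w) t : ℝ) ^ 2)
      ((fun w : ℂ => 1 / w) ⁻¹' Metric.closedBall 0 b ∩ Metric.closedBall 0 η)
    rw [hpre] at h1
    -- The sets differ only at $w=0$, where $1/0=0$ lies in the ball.
    have hae : ((fun w : ℂ => 1 / w) ⁻¹' Metric.closedBall 0 b ∩ Metric.closedBall 0 η : Set ℂ)
        =ᵐ[volume] (Metric.closedBall 0 η \ Metric.ball 0 (1 / b) : Set ℂ) := by
      have hne : ∀ᵐ w : ℂ ∂volume, w ≠ 0 := by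
        rw [ae_iff]; simp
      refine eventuallyEq_set.2 ?_
      filter_upwards [hne] with w hw
      have hpos : 0 < ‖w‖ := norm_pos_iff.2 hw
      simp only [Set.mem_inter_iff, Set.mem_preimage, mem_closedBall_zero_iff, norm_div, norm_one,
        Set.mem_sdiff, mem_ball_zero_iff, not_lt, div_le_iff₀ hpos, div_le_iff₀ hb]
      rw [mul_comm b, and_comm]
    rw [h1, setIntegral_congr_set hae, setIntegral_annulus_inner_sq t (by positivity) hbη',
      div_div_eq_mul_div, div_one, Real.log_mul hη.ne' hb.ne', add_comm (Real.log η)]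
  set I := Real.pi * ‖t‖ ^ 2 * (Real.log b + Real.log η) with hI
  have hI0 : 0 ≤ I := by rw [← hvol]; exact integral_nonneg fun x => by positivity
  have hrestr : ∀ (ρ : Measure ℂ), (ρ.restrict B).restrict E = ρ.restrict (E ∩ B) := fun ρ =>
    Measure.restrict_restrict hEm
  have hle1 : ν.restrict (E ∩ B) ≤ ENNReal.ofReal (p u + ε) • volume.restrict (E ∩ B) := by
    have := Measure.restrict_mono_measure H1 E
    rwa [Measure.restrict_smul, hrestr, hrestr] at this
  have hle2 : ENNReal.ofReal (p u - ε) • volume.restrict (E ∩ B) ≤ ν.restrict (E ∩ B) := by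
    have := Measure.restrict_mono_measure H2 E
    rwa [Measure.restrict_smul, hrestr, hrestr] at this
  have hup : ∫ x in E ∩ B, (inner ℝ (1 / (u - x)) t : ℝ) ^ 2 ∂ν ≤ (p u + ε) * I := by
    have := integral_mono_measure hle1 (ae_of_all _ fun x => by positivity)
      ((hbound volume hvolfin).smul_measure ENNReal.ofReal_ne_top)
    rwa [integral_smul_measure, hvol, ENNReal.toReal_ofReal (by linarith), smul_eq_mul] at this
  -- If $p(u)<\varepsilon$, `ENNReal.ofReal` cuts the factor to $0$, which only strengthens the
  -- lower bound because $I\ge0$.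
  have hlow : (p u - ε) * I ≤ ∫ x in E ∩ B, (inner ℝ (1 / (u - x)) t : ℝ) ^ 2 ∂ν := by
    have := integral_mono_measure hle2 (ae_of_all _ fun x => by positivity)
      (hbound ν (measure_lt_top _ _))
    rw [integral_smul_measure, hvol, smul_eq_mul] at this
    refine le_trans ?_ this
    gcongr
    rw [ENNReal.toReal_ofReal']
    exact le_max_left _ _
  have hout0 : 0 ≤ ∫ x in E \ B, (inner ℝ (1 / (u - x)) t : ℝ) ^ 2 ∂ν :=
    integral_nonneg fun x => by positivity
  have hout : ∫ x in E \ B, (inner ℝ (1 / (u - x)) t : ℝ) ^ 2 ∂ν ≤ ‖t‖ ^ 2 / η ^ 2 := by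
    have h1 : ∀ x ∈ E \ B, ‖(inner ℝ (1 / (u - x)) t : ℝ) ^ 2‖ ≤ ‖t‖ ^ 2 / η ^ 2 := by
      intro x hx
      have hx2 : η < ‖u - x‖ := by
        have := hx.2
        rw [hB, Metric.mem_closedBall, dist_comm, dist_eq_norm, not_le] at this
        exact this
      rw [norm_pow, Real.norm_eq_abs, ← div_pow]
      gcongr
      refine (abs_real_inner_le_norm _ _).trans ?_
      rw [norm_div, norm_one, one_div_mul_eq_div]
      gcongr
    have h2 := norm_setIntegral_le_of_norm_le_const (measure_lt_top ν (E \ B)) h1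
    refine ((le_abs_self _).trans h2).trans ?_
    exact mul_le_of_le_one_right (by positivity) measureReal_le_one
  have hsplit := integral_inter_add_sdiff hBm hνint
  rw [← hsplit, abs_le]
  set J := ∫ x in E ∩ B, (inner ℝ (1 / (u - x)) t : ℝ) ^ 2 ∂ν
  set J' := ∫ x in E \ B, (inner ℝ (1 / (u - x)) t : ℝ) ^ 2 ∂ν
  have hA : 0 ≤ Real.pi * ‖t‖ ^ 2 := by positivity
  set A := Real.pi * ‖t‖ ^ 2
  have e1 : Real.pi * p u * ‖t‖ ^ 2 = p u * A := by simp only [A]; ring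
  rw [e1]
  have hη1 : A * Real.log η ≤ A * |Real.log η| := by gcongr; exact le_abs_self _
  have hη2 : -(A * |Real.log η|) ≤ A * Real.log η := by
    rw [← mul_neg]; gcongr; exact neg_abs_le _
  have hpη1 : (p u + ε) * (A * Real.log η) ≤ (p u + ε) * (A * |Real.log η|) := by gcongr
  have hq : (0 : ℝ) ≤ ‖t‖ ^ 2 / η ^ 2 := by positivity
  have hpη2 : -((p u + ε) * (A * |Real.log η|)) ≤ (p u - ε) * (A * Real.log η) := by
    have : |(p u - ε) * (A * Real.log η)| ≤ (p u + ε) * (A * |Real.log η|) := by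
      rw [abs_mul, abs_mul, abs_of_nonneg hA]
      gcongr
      rw [abs_le]; constructor <;> linarith
    linarith [neg_abs_le ((p u - ε) * (A * Real.log η))]
  rw [hI] at hup hlow
  constructor <;> nlinarith

/-- The truncated second moment of `1 / (u - x)` grows logarithmically. -/
theorem HasLebesgueDensityOn.tendsto_truncated_second_moment {ν : Measure ℂ}
    [IsProbabilityMeasure ν] {p : ℂ → ℝ} {u : ℂ}
    {δ : ℝ} (hδ : 0 < δ) (h : HasLebesgueDensityOn ν p (Metric.closedBall u δ))
    (hp : ContinuousAt p u) (t : ℂ) :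
    Tendsto (fun b => (∫ y in Metric.closedBall 0 b, (inner ℝ y t : ℝ) ^ 2
      ∂(ν.map fun x => 1 / (u - x))) / Real.log b) atTop (𝓝 (Real.pi * p u * ‖t‖ ^ 2)) := by
  rw [Metric.tendsto_nhds]
  intro ε hε
  have hA : 0 ≤ Real.pi * ‖t‖ ^ 2 := by positivity
  obtain ⟨C, hC⟩ := h.exists_truncated_second_moment_bounds hδ hp t
    -- The added $1$ covers $t=0$.
    (show 0 < ε / (2 * (Real.pi * ‖t‖ ^ 2 + 1)) by positivity)
  have hlim : Tendsto (fun b => C / Real.log b) atTop (𝓝 0) :=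
    Real.tendsto_log_atTop.const_div_atTop C
  filter_upwards [hC, hlim.eventually_lt_const (half_pos hε), eventually_gt_atTop 1]
    with b hb hCb hb1
  have hlog : 0 < Real.log b := Real.log_pos hb1
  rw [Real.dist_eq]
  have e : ∀ J K : ℝ, J / Real.log b - K = (J - K * Real.log b) / Real.log b := by
    intro J K; field_simp
  rw [e, abs_div, abs_of_pos hlog]
  refine (div_le_div_of_nonneg_right hb hlog.le).trans_lt ?_
  rw [add_div, mul_div_cancel_right₀ _ hlog.ne']
  have : ε / (2 * (Real.pi * ‖t‖ ^ 2 + 1)) * (Real.pi * ‖t‖ ^ 2) ≤ ε / 2 := by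
    rw [div_mul_eq_mul_div, div_le_div_iff₀ (by positivity) two_pos]
    nlinarith
  linarith

theorem setIntegral_closedBall_norm_sq (κ : Measure ℂ) [IsFiniteMeasure κ] (b : ℝ) :
    ∫ y in Metric.closedBall 0 b, ‖y‖ ^ 2 ∂κ =
      ∫ y in Metric.closedBall 0 b, (inner ℝ y (1 : ℂ) : ℝ) ^ 2 ∂κ +
        ∫ y in Metric.closedBall 0 b, (inner ℝ y Complex.I : ℝ) ^ 2 ∂κ := by
  rw [← integral_add (integrableOn_inner_sq_closedBall κ 1 b)
    (integrableOn_inner_sq_closedBall κ Complex.I b)]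
  congr 1
  ext y
  simp only [Complex.inner, Complex.sq_norm, Complex.normSq_apply]
  simp
  ring

theorem HasLebesgueDensityOn.tendsto_truncated_norm_sq {ν : Measure ℂ}
    [IsProbabilityMeasure ν] {p : ℂ → ℝ} {u : ℂ}
    {δ : ℝ} (hδ : 0 < δ) (h : HasLebesgueDensityOn ν p (Metric.closedBall u δ))
    (hp : ContinuousAt p u) :
    Tendsto (fun b => (∫ y in Metric.closedBall 0 b, ‖y‖ ^ 2
      ∂(ν.map fun x => 1 / (u - x))) / Real.log b) atTop (𝓝 (2 * Real.pi * p u)) := by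
  have : IsProbabilityMeasure (ν.map fun x => 1 / (u - x)) :=
    Measure.isProbabilityMeasure_map (by fun_prop)
  have := (h.tendsto_truncated_second_moment hδ hp 1).add
    (h.tendsto_truncated_second_moment hδ hp Complex.I)
  simp_rw [setIntegral_closedBall_norm_sq, add_div]
  convert this using 2
  simp
  ring

/-! ### Characteristic functions and the central limit theorem -/

/-- The characteristic function of the complex normal law. -/
theorem charFun_complexNormal (v : ℝ≥0) (t : ℂ) :
    charFun (complexNormal v) t = Complex.exp (-(v * ‖t‖ ^ 2 / 4 : ℝ)) := by
  rw [complexNormal, charFun_apply, integral_map (by fun_prop) (by fun_prop)]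
  have h : ∀ x : ℝ × ℝ, Complex.exp ((inner ℝ ((x.1 : ℂ) + x.2 * Complex.I) t : ℝ) * Complex.I) =
      Complex.exp (t.re * x.1 * Complex.I) * Complex.exp (t.im * x.2 * Complex.I) := by
    intro x
    rw [← Complex.exp_add, Complex.inner]
    congr 1
    simp
    ring
  simp_rw [h]
  rw [integral_prod_mul (fun x : ℝ => Complex.exp (t.re * x * Complex.I))
    (fun x : ℝ => Complex.exp (t.im * x * Complex.I)), ← charFun_apply_real, ← charFun_apply_real,
    charFun_gaussianReal, charFun_gaussianReal, ← Complex.exp_add]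
  congr 1
  rw [Complex.sq_norm, Complex.normSq_apply]
  push_cast
  ring

/-- Used outside the truncation set, where only a first moment is available. -/
theorem norm_exp_mul_I_sub_le (x : ℝ) : ‖Complex.exp (x * Complex.I) - 1 - x * Complex.I‖ ≤
    2 * |x| := by
  have h1 : ‖Complex.exp (x * Complex.I) - 1‖ ≤ |x| := by
    rw [mul_comm]; exact Real.norm_exp_I_mul_ofReal_sub_one_le
  have h2 : ‖(x : ℂ) * Complex.I‖ = |x| := by simp
  linarith [norm_sub_le (Complex.exp (x * Complex.I) - 1) (x * Complex.I)]

theorem norm_exp_mul_I_sub_add_le {x : ℝ} (hx : |x| ≤ 1) :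
    ‖Complex.exp (x * Complex.I) - 1 - x * Complex.I + ((x ^ 2 / 2 : ℝ) : ℂ)‖ ≤ |x| ^ 3 := by
  have h2 : ‖(x : ℂ) * Complex.I‖ = |x| := by simp
  have h := Complex.exp_bound (x := x * Complex.I) (by rwa [h2]) (n := 3) (by norm_num)
  rw [h2] at h
  have e : Complex.exp (x * Complex.I) - 1 - x * Complex.I + ((x ^ 2 / 2 : ℝ) : ℂ) =
      Complex.exp (x * Complex.I) -
        ∑ m ∈ Finset.range 3, ((x : ℂ) * Complex.I) ^ m / m.factorial := by
    simp [Finset.sum_range_succ, mul_pow, Nat.factorial]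
    ring
  rw [e]
  -- The Taylor remainder constant is $4/(3!\cdot3)=2/9$.
  refine h.trans (mul_le_of_le_one_right (by positivity) ?_)
  norm_num [Nat.factorial]

/-- Second order expansion of a characteristic function, with a truncated second moment. -/
theorem norm_integral_exp_sub_one_add_le {α : Type*} [MeasurableSpace α] {κ : Measure α}
    [IsFiniteMeasure κ] {X : α → ℝ} (hX : Measurable X) (hint : Integrable X κ)
    (h0 : ∫ y, X y ∂κ = 0) {B : Set α} (hB : MeasurableSet B) {η : ℝ} (hη : η ≤ 1)
    (hXB : ∀ y ∈ B, |X y| ≤ η) :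
    ‖∫ y, (Complex.exp (X y * Complex.I) - 1) ∂κ + ((1 / 2 * ∫ y in B, X y ^ 2 ∂κ : ℝ) : ℂ)‖ ≤
      η * ∫ y in B, X y ^ 2 ∂κ + 2 * ∫ y in Bᶜ, |X y| ∂κ := by
  have hE : Integrable (fun y => Complex.exp (X y * Complex.I) - 1) κ := by
    refine Integrable.of_bound (Measurable.aestronglyMeasurable (by fun_prop)) 2
      (ae_of_all _ fun y => ?_)
    refine (norm_sub_le _ _).trans ?_
    rw [Complex.norm_exp_ofReal_mul_I]; norm_num
  have hXc : Integrable (fun y => (X y : ℂ) * Complex.I) κ := hint.ofReal.mul_const _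
  have hsq : IntegrableOn (fun y => X y ^ 2) B κ := by
    refine IntegrableOn.of_bound (measure_lt_top _ _)
      (Measurable.aestronglyMeasurable (by fun_prop)) 1 ?_
    refine (ae_restrict_iff' hB).2 (ae_of_all _ fun y hy => ?_)
    rw [norm_pow, Real.norm_eq_abs]
    exact pow_le_one₀ (abs_nonneg _) ((hXB y hy).trans hη)
  have hR : Integrable (fun y => Complex.exp (X y * Complex.I) - 1 - X y * Complex.I) κ :=
    hE.sub hXc
  -- The mean is zero, so the linear term can be subtracted at no cost.
  have e1 : ∫ y, (Complex.exp (X y * Complex.I) - 1) ∂κ =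
      ∫ y, (Complex.exp (X y * Complex.I) - 1 - X y * Complex.I) ∂κ := by
    rw [integral_sub hE hXc, integral_mul_const, integral_complex_ofReal, h0]
    simp
  have e2 : ((1 / 2 * ∫ y in B, X y ^ 2 ∂κ : ℝ) : ℂ) = ∫ y in B, ((X y ^ 2 / 2 : ℝ) : ℂ) ∂κ := by
    rw [integral_complex_ofReal, integral_div]
    congr 1
    ring
  have hsqc : IntegrableOn (fun y => ((X y ^ 2 / 2 : ℝ) : ℂ)) B κ := (hsq.div_const 2).ofReal
  rw [e1, e2, ← integral_add_compl hB hR, add_right_comm, ← integral_add hR.integrableOn hsqc]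
  refine (norm_add_le _ _).trans (add_le_add ?_ ?_)
  · rw [← integral_const_mul]
    refine norm_integral_le_of_norm_le (hsq.const_mul η) ?_
    refine (ae_restrict_iff' hB).2 (ae_of_all _ fun y hy => ?_)
    have h1 := hXB y hy
    refine (norm_exp_mul_I_sub_add_le (h1.trans hη)).trans ?_
    calc |X y| ^ 3 = |X y| * X y ^ 2 := by rw [← sq_abs (X y)]; ring
      _ ≤ η * X y ^ 2 := by gcongr
  · rw [← integral_const_mul]
    exact norm_integral_le_of_norm_le (hint.abs.integrableOn.const_mul 2)
      (ae_of_all _ fun y => norm_exp_mul_I_sub_le _)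

/-- Truncate at $|y|\le\sqrt n$. The quadratic part `M n` tends to $v|t|^2/2$ as $\log\sqrt
n=\frac12\log n$. Inside the cutoff the scaled variable is at most $\eta_n=K/\sqrt{\log n}$, so the
cubic error is at most $\eta_nM_n$; the tail contributes $O(1/\sqrt{\log n})$ through the $C/b$
bound. -/
theorem tendsto_nat_mul_integral_exp_sub_one {κ : Measure ℂ} [IsProbabilityMeasure κ]
    (hint : Integrable (fun y : ℂ => y) κ) {v : ℝ} (t : ℂ)
    (H1 : Tendsto (fun b => (∫ y in Metric.closedBall 0 b, (inner ℝ y t : ℝ) ^ 2 ∂κ) / Real.log b)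
      atTop (𝓝 (v * ‖t‖ ^ 2)))
    (H2 : ∃ C : ℝ, ∀ᶠ b in atTop, ∫ y in (Metric.closedBall 0 b)ᶜ, ‖y‖ ∂κ ≤ C / b) :
    Tendsto (fun n : ℕ => (n : ℂ) * ∫ y, (Complex.exp (((inner ℝ (y - ∫ y, y ∂κ) t /
      √(n * Real.log n) : ℝ) : ℂ) * Complex.I) - 1) ∂κ) atTop
      (𝓝 (-(v * ‖t‖ ^ 2 / 4 : ℝ) : ℂ)) := by
  set m := ∫ y, y ∂κ with hm
  obtain ⟨C, hC⟩ := H2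
  set s : ℕ → ℝ := fun n => √(n * Real.log n) with hs
  set B : ℕ → Set ℂ := fun n => Metric.closedBall 0 (√(n : ℝ)) with hB
  set K := ‖t‖ * (1 + ‖m‖) with hK
  have hBm : ∀ n, MeasurableSet (B n) := fun n => measurableSet_closedBall
  have hXint : Integrable (fun y : ℂ => (inner ℝ (y - m) t : ℝ)) κ := by
    have : Integrable (fun y : ℂ => (inner ℝ t (y - m) : ℝ)) κ :=
      (hint.sub (integrable_const m)).const_inner t
    simpa only [real_inner_comm] using this
  have hLint : Integrable (fun y : ℂ => (inner ℝ y t : ℝ)) κ := by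
    have : Integrable (fun y : ℂ => (inner ℝ t y : ℝ)) κ := hint.const_inner t
    simpa only [real_inner_comm] using this
  have hX0 : ∫ y, (inner ℝ (y - m) t : ℝ) ∂κ = 0 := by
    have : ∫ y, (inner ℝ t (y - m) : ℝ) ∂κ = inner ℝ t (∫ y, (y - m) ∂κ) :=
      integral_inner (hint.sub (integrable_const m)) t
    rw [integral_sub hint (integrable_const m), ← hm] at this
    simpa [real_inner_comm] using this
  set η : ℕ → ℝ := fun n => K / √(Real.log n) with hη
  set M : ℕ → ℝ := fun n => n * ∫ y in B n, (inner ℝ (y - m) t / s n : ℝ) ^ 2 ∂κ with hM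
  set D : ℕ → ℝ := fun n => n * ∫ y in (B n)ᶜ, |(inner ℝ (y - m) t / s n : ℝ)| ∂κ with hD
  have hlogtop : Tendsto (fun n : ℕ => Real.log n) atTop atTop :=
    Real.tendsto_log_atTop.comp tendsto_natCast_atTop_atTop
  have hsqrttop : Tendsto (fun n : ℕ => √(n : ℝ)) atTop atTop :=
    Real.tendsto_sqrt_atTop.comp tendsto_natCast_atTop_atTop
  have hsqlog : Tendsto (fun n : ℕ => √(Real.log n)) atTop atTop :=
    Real.tendsto_sqrt_atTop.comp hlogtop
  have hηlim : Tendsto η atTop (𝓝 0) := hsqlog.const_div_atTop K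
  have hsval : ∀ n : ℕ, s n = √(n : ℝ) * √(Real.log n) := fun n =>
    Real.sqrt_mul (Nat.cast_nonneg n) _
  have hlarge : ∀ᶠ n : ℕ in atTop, 1 < n := eventually_gt_atTop 1
  have hMlim : Tendsto M atTop (𝓝 (v * ‖t‖ ^ 2 / 2)) := by
    have a1 := (H1.comp hsqrttop).div_const 2
    -- Centering at $m$ changes the truncated second moment by a bounded amount, which division by
    -- $\log n$ removes.
    have hbdd : ∀ n, |(-2 * inner ℝ m t * ∫ y in B n, (inner ℝ y t : ℝ) ∂κ) +
        (inner ℝ m t : ℝ) ^ 2 * κ.real (B n)| ≤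
        2 * |inner ℝ m t| * (∫ y, |(inner ℝ y t : ℝ)| ∂κ) + (inner ℝ m t : ℝ) ^ 2 := by
      intro n
      refine (abs_add_le _ _).trans (add_le_add ?_ ?_)
      · rw [abs_mul, abs_mul, abs_neg, abs_two]
        gcongr
        exact (abs_integral_le_integral_abs).trans
          (setIntegral_le_integral hLint.abs (ae_of_all _ fun y => abs_nonneg _))
      · rw [abs_of_nonneg (by positivity)]
        exact mul_le_of_le_one_right (by positivity) measureReal_le_one
    have a2 : Tendsto (fun n : ℕ => ((-2 * inner ℝ m t * ∫ y in B n, (inner ℝ y t : ℝ) ∂κ) +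
        (inner ℝ m t : ℝ) ^ 2 * κ.real (B n)) / Real.log n) atTop (𝓝 0) := by
      refine squeeze_zero_norm' ?_ (hlogtop.const_div_atTop
        (2 * |inner ℝ m t| * (∫ y, |(inner ℝ y t : ℝ)| ∂κ) + (inner ℝ m t : ℝ) ^ 2))
      filter_upwards [hlarge] with n hn
      have : 0 < Real.log n := Real.log_pos (by exact_mod_cast hn)
      rw [norm_div, Real.norm_eq_abs, Real.norm_of_nonneg this.le]
      gcongr
      exact hbdd n
    have a3 := a1.add a2
    rw [add_zero] at a3
    refine a3.congr' ?_
    filter_upwards [hlarge] with n hn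
    have hn0 : (0 : ℝ) < n := by exact_mod_cast (zero_lt_one.trans hn)
    have hl : 0 < Real.log n := Real.log_pos (by exact_mod_cast hn)
    have e1 : ∫ y in B n, (inner ℝ (y - m) t / s n : ℝ) ^ 2 ∂κ =
        (∫ y in B n, (inner ℝ y t : ℝ) ^ 2 ∂κ + (-2 * inner ℝ m t * ∫ y in B n,
        (inner ℝ y t : ℝ) ∂κ + (inner ℝ m t : ℝ) ^ 2 * κ.real (B n))) / (n * Real.log n) := by
      rw [← Real.sq_sqrt (show 0 ≤ n * Real.log n by positivity), ← integral_const_mul]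
      have : (inner ℝ m t : ℝ) ^ 2 * κ.real (B n) = ∫ y in B n, (inner ℝ m t : ℝ) ^ 2 ∂κ := by
        rw [setIntegral_const, smul_eq_mul, mul_comm]
      have hi1 : IntegrableOn (fun y : ℂ => -2 * inner ℝ m t * (inner ℝ y t : ℝ)) (B n) κ :=
        hLint.integrableOn.const_mul _
      have hi2 : IntegrableOn (fun y : ℂ => -2 * inner ℝ m t * (inner ℝ y t : ℝ) +
          (inner ℝ m t : ℝ) ^ 2) (B n) κ := hi1.add (integrable_const _)
      rw [this, ← integral_add hi1 (integrable_const _),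
        ← integral_add (integrableOn_inner_sq_closedBall κ t (√(n : ℝ))) hi2, ← integral_div]
      congr 1
      ext y
      rw [inner_sub_left, div_pow]
      congr 1
      ring
    simp only [hM, Function.comp_apply]
    rw [e1, Real.log_sqrt hn0.le]
    simp only [hB]
    field_simp
  have hDlim : Tendsto D atTop (𝓝 0) := by
    have hb := (hsqlog.const_div_atTop (K * C))
    refine squeeze_zero' (Eventually.of_forall fun n => ?_) ?_ hb
    · exact mul_nonneg (Nat.cast_nonneg n) (integral_nonneg fun y => abs_nonneg _)
    filter_upwards [hlarge, hsqrttop.eventually hC, hsqrttop.eventually_ge_atTop 1]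
      with n hn hCn hn1
    have hn0 : (0 : ℝ) < n := by exact_mod_cast (zero_lt_one.trans hn)
    have hl : 0 < Real.log n := Real.log_pos (by exact_mod_cast hn)
    have hs0 : 0 < s n := Real.sqrt_pos.2 (by positivity)
    have h1 : ∫ y in (B n)ᶜ, |(inner ℝ (y - m) t / s n : ℝ)| ∂κ ≤
        ∫ y in (B n)ᶜ, K / s n * ‖y‖ ∂κ := by
      refine setIntegral_mono_on (hXint.div_const _).abs.integrableOn
        (hint.norm.integrableOn.const_mul _) (hBm n).compl fun y hy => ?_
      have hy1 : 1 ≤ ‖y‖ := by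
        have : √(n : ℝ) < ‖y‖ := by simpa [hB] using hy
        linarith
      rw [abs_div, abs_of_pos hs0, div_mul_eq_mul_div]
      gcongr
      calc |(inner ℝ (y - m) t : ℝ)| ≤ ‖y - m‖ * ‖t‖ := abs_real_inner_le_norm _ _
        _ ≤ (‖y‖ + ‖m‖) * ‖t‖ := by gcongr; exact norm_sub_le _ _
        _ ≤ (‖y‖ + ‖m‖ * ‖y‖) * ‖t‖ := by
          gcongr; exact le_mul_of_one_le_right (norm_nonneg _) hy1
        _ = K * ‖y‖ := by rw [hK]; ring
    rw [integral_const_mul] at h1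
    calc D n ≤ n * (K / s n * (C / √(n : ℝ))) := by
          simp only [hD]
          gcongr
          refine h1.trans ?_
          gcongr
      _ = K * C / √(Real.log n) := by
          rw [hsval]
          have : (0 : ℝ) < √(n : ℝ) := Real.sqrt_pos.2 hn0
          have : (0 : ℝ) < √(Real.log n) := Real.sqrt_pos.2 hl
          field_simp
          rw [Real.sq_sqrt hn0.le]
          ring
  have hdiff : Tendsto (fun n : ℕ => (n : ℂ) * ∫ y, (Complex.exp (((inner ℝ (y - m) t /
      s n : ℝ) : ℂ) * Complex.I) - 1) ∂κ + ((1 / 2 * M n : ℝ) : ℂ)) atTop (𝓝 0) := by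
    have hb : Tendsto (fun n => η n * M n + 2 * D n) atTop (𝓝 0) := by
      simpa using (hηlim.mul hMlim).add (hDlim.const_mul 2)
    refine squeeze_zero_norm' ?_ hb
    filter_upwards [hlarge, hηlim.eventually_le_const zero_lt_one,
      hsqrttop.eventually_ge_atTop 1] with n hn hηn hn1
    have hn0 : (0 : ℝ) < n := by exact_mod_cast (zero_lt_one.trans hn)
    have hl : 0 < Real.log n := Real.log_pos (by exact_mod_cast hn)
    have hs0 : 0 < s n := Real.sqrt_pos.2 (by positivity)
    have key := norm_integral_exp_sub_one_add_le (κ := κ)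
      (X := fun y : ℂ => (inner ℝ (y - m) t / s n : ℝ)) (by fun_prop) (hXint.div_const _)
      (by rw [integral_div, hX0, zero_div]) (hBm n) hηn (fun y hy => by
        have hy1 : ‖y‖ ≤ √(n : ℝ) := by simpa [hB] using hy
        have hq : 0 < √(n : ℝ) := by linarith
        rw [abs_div, abs_of_pos hs0, hsval]
        calc |(inner ℝ (y - m) t : ℝ)| / (√(n : ℝ) * √(Real.log n))
            ≤ (K * √(n : ℝ)) / (√(n : ℝ) * √(Real.log n)) := by
              gcongr
              calc |(inner ℝ (y - m) t : ℝ)| ≤ ‖y - m‖ * ‖t‖ := abs_real_inner_le_norm _ _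
                _ ≤ (‖y‖ + ‖m‖) * ‖t‖ := by gcongr; exact norm_sub_le _ _
                _ ≤ (√(n : ℝ) + ‖m‖ * √(n : ℝ)) * ‖t‖ := by
                  gcongr; exact le_mul_of_one_le_right (norm_nonneg _) hn1
                _ = K * √(n : ℝ) := by rw [hK]; ring
          _ = η n := by
              have : (0 : ℝ) < √(Real.log n) := Real.sqrt_pos.2 hl
              simp only [hη]
              field_simp)
    have e1 : (n : ℂ) * ∫ y, (Complex.exp (((inner ℝ (y - m) t /
        s n : ℝ) : ℂ) * Complex.I) - 1) ∂κ + ((1 / 2 * M n : ℝ) : ℂ) =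
        (n : ℂ) * (∫ y, (Complex.exp (((inner ℝ (y - m) t /
        s n : ℝ) : ℂ) * Complex.I) - 1) ∂κ + ((1 / 2 * ∫ y in B n,
          (inner ℝ (y - m) t / s n : ℝ) ^ 2 ∂κ : ℝ) : ℂ)) := by
      simp only [hM]
      push_cast
      ring
    rw [e1, norm_mul, Complex.norm_natCast]
    calc _ ≤ _ := mul_le_mul_of_nonneg_left key (Nat.cast_nonneg n)
      _ = η n * M n + 2 * D n := by simp only [hM, hD]; ring
  have hM' : Tendsto (fun n => ((1 / 2 * M n : ℝ) : ℂ)) atTop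
      (𝓝 ((1 / 2 * (v * ‖t‖ ^ 2 / 2) : ℝ) : ℂ)) :=
    (Complex.continuous_ofReal.tendsto _).comp (hMlim.const_mul (1 / 2))
  have := hdiff.sub hM'
  simp only [add_sub_cancel_right, zero_sub] at this
  convert this using 2
  push_cast
  ring

/-- **Central limit theorem** for complex random variables whose truncated second moments grow
logarithmically. -/
theorem tendstoInDistribution_sum_sub_of_log_second_moment {Ω : Type*} [MeasurableSpace Ω]
    {μ : Measure Ω} [IsProbabilityMeasure μ] {Y : ℕ → Ω → ℂ} (hindep : iIndepFun Y μ)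
    (hident : ∀ k, IdentDistrib (Y k) (Y 0) μ μ) (hint : Integrable (Y 0) μ) {v : ℝ} (hv : 0 ≤ v)
    (H1 : ∀ t : ℂ, Tendsto (fun b => (∫ y in Metric.closedBall 0 b, (inner ℝ y t : ℝ) ^ 2
      ∂(μ.map (Y 0))) / Real.log b) atTop (𝓝 (v * ‖t‖ ^ 2)))
    (H2 : ∃ C : ℝ, ∀ᶠ b in atTop, ∫ y in (Metric.closedBall 0 b)ᶜ, ‖y‖ ∂(μ.map (Y 0)) ≤ C / b) :
    TendstoInDistribution (fun (n : ℕ) ω => (√(n * Real.log n))⁻¹ •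
      (∑ k ∈ Finset.range n, Y k ω - n * ∫ ω, Y 0 ω ∂μ)) atTop (fun z : ℂ => z) (fun _ => μ)
      (complexNormal v.toNNReal) := by
  have hm : ∀ k, AEMeasurable (Y k) μ := fun k => (hident k).aemeasurable_fst
  set m := ∫ ω, Y 0 ω ∂μ with hmdef
  set κ := μ.map (Y 0) with hκ
  have hκp : IsProbabilityMeasure κ := Measure.isProbabilityMeasure_map (hm 0)
  have hmκ : ∫ y, y ∂κ = m := integral_map (hm 0) (by fun_prop)
  have hintκ : Integrable (fun y : ℂ => y) κ :=
    (integrable_map_measure (by fun_prop) (hm 0)).2 hint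
  have hXm : ∀ k, AEMeasurable (fun ω => Y k ω - m) μ := fun k => (hm k).sub_const m
  have hXind : iIndepFun (fun k ω => Y k ω - m) μ :=
    hindep.comp (fun _ x => x - m) (fun _ => by fun_prop)
  have hXid : ∀ k, IdentDistrib (fun ω => Y k ω - m) (fun ω => Y 0 ω - m) μ μ := fun k =>
    (hident k).comp (u := fun x => x - m) (by fun_prop)
  have hsum : (fun (n : ℕ) ω => (√(n * Real.log n))⁻¹ •
      (∑ k ∈ Finset.range n, Y k ω - n * m)) = fun (n : ℕ) ω => (√(n * Real.log n))⁻¹ •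
      ∑ k ∈ Finset.range n, (Y k ω - m) := by
    ext n ω
    simp [Finset.sum_sub_distrib]
  rw [hsum]
  have hSm : ∀ n : ℕ, AEMeasurable (fun ω => ∑ k ∈ Finset.range n, (Y k ω - m)) μ := fun n =>
    Finset.aemeasurable_fun_sum _ fun k _ => hXm k
  refine ⟨fun n => (hSm n).fun_const_smul _, by fun_prop, ?_⟩
  refine ProbabilityMeasure.tendsto_iff_tendsto_charFun.2 fun t => ?_
  simp only [ProbabilityMeasure.coe_mk]
  rw [show (complexNormal v.toNNReal).map (fun z : ℂ => z) = complexNormal v.toNNReal from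
    Measure.map_id, charFun_complexNormal, Real.coe_toNNReal v hv]
  have hmain := tendsto_nat_mul_integral_exp_sub_one hintκ t (H1 t) H2
  rw [hmκ] at hmain
  -- By independence the characteristic function is an $n$-th power $(1+c_n)^n$, with $n c_n$
  -- convergent by `hmain`.
  refine (Complex.tendsto_one_add_pow_exp_of_tendsto hmain).congr fun n => ?_
  rw [charFun_map_smul_comp (hSm n), (hXind.restrict _).charFun_map_fun_finsetSum_eq_prod
    (fun _ _ => hXm _)]
  simp only [fun i => (hXid i).map_eq, Finset.prod_const, Finset.card_range, Pi.pow_apply]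
  congr 1
  have e1 : charFun (μ.map fun ω => Y 0 ω - m) ((√(n * Real.log n))⁻¹ • t) =
      ∫ y, Complex.exp (((inner ℝ (y - m) t / √(n * Real.log n) : ℝ) : ℂ) * Complex.I) ∂κ := by
    rw [charFun_apply, integral_map (hXm 0) (by fun_prop), hκ, integral_map (hm 0)
      (Measurable.aestronglyMeasurable (by fun_prop))]
    congr 1
    ext ω
    rw [inner_smul_right, div_eq_inv_mul]
  rw [integral_sub, e1]
  · simp
  · refine Integrable.of_bound (Measurable.aestronglyMeasurable (by fun_prop)) 1
      (ae_of_all _ fun y => ?_)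
    rw [Complex.norm_exp_ofReal_mul_I]
  · exact integrable_const _

/-! ### Probabilities of the exceptional events -/

theorem tendsto_measure_zero_of_subset {Ω : Type*} [MeasurableSpace Ω] {μ : Measure Ω}
    {s t : ℕ → Set Ω} (h : ∀ᶠ n in atTop, s n ⊆ t n) (ht : Tendsto (fun n => μ (t n)) atTop (𝓝 0)) :
    Tendsto (fun n => μ (s n)) atTop (𝓝 0) :=
  tendsto_of_tendsto_of_tendsto_of_le_of_le' tendsto_const_nhds ht
    (Eventually.of_forall fun _ => zero_le) (h.mono fun _ hn => measure_mono hn)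

theorem tendsto_measure_union_zero {Ω : Type*} [MeasurableSpace Ω] {μ : Measure Ω}
    {s t : ℕ → Set Ω} (hs : Tendsto (fun n => μ (s n)) atTop (𝓝 0))
    (ht : Tendsto (fun n => μ (t n)) atTop (𝓝 0)) :
    Tendsto (fun n => μ (s n ∪ t n)) atTop (𝓝 0) := by
  have := hs.add ht
  rw [add_zero] at this
  exact tendsto_of_tendsto_of_tendsto_of_le_of_le tendsto_const_nhds this
    (fun _ => zero_le) (fun _ => measure_union_le _ _)

/-- With high probability none of the first `n` points is within `o(1/√n)` of `u`. -/
theorem tendsto_measure_exists_norm_sub_le {Ω : Type*} [MeasurableSpace Ω] {μ : Measure Ω}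
    {ξ : ℕ → Ω → ℂ} (hident : ∀ k, IdentDistrib (ξ k) (ξ 0) μ μ)
    {u : ℂ} {p : ℂ → ℝ} {δ : ℝ} (hδ : 0 < δ)
    (hdens : HasLebesgueDensityOn (μ.map (ξ 0)) p (Metric.closedBall u δ))
    (hp : ContinuousAt p u) {ρ : ℕ → ℝ} (hρ0 : ∀ᶠ n in atTop, 0 ≤ ρ n)
    (hρ : Tendsto (fun n : ℕ => √(n : ℝ) * ρ n) atTop (𝓝 0)) :
    Tendsto (fun n : ℕ => μ {ω | ∃ k ∈ Finset.range n, ‖u - ξ k ω‖ ≤ ρ n}) atTop (𝓝 0) := by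
  obtain ⟨C, η, hη, hC, H⟩ := hdens.exists_measure_closedBall_le hδ hp
  -- This is the union bound $n\cdot C\rho_n^2$, rewritten.
  have hlim : Tendsto (fun n : ℕ => ENNReal.ofReal (C * (√(n : ℝ) * ρ n) ^ 2)) atTop (𝓝 0) := by
    have := ENNReal.tendsto_ofReal ((hρ.pow 2).const_mul C)
    simpa using this
  have hρη : ∀ᶠ n in atTop, ρ n ≤ η := by
    filter_upwards [hρ.eventually_le_const hη, hρ0, eventually_ge_atTop 1] with n hn hn0 hn1
    have h1 : 1 ≤ √(n : ℝ) := Real.one_le_sqrt.2 (by exact_mod_cast hn1)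
    nlinarith
  refine tendsto_of_tendsto_of_tendsto_of_le_of_le' tendsto_const_nhds hlim
    (Eventually.of_forall fun _ => zero_le) ?_
  filter_upwards [hρη, hρ0] with n hn hn0
  have hsub : {ω | ∃ k ∈ Finset.range n, ‖u - ξ k ω‖ ≤ ρ n} ⊆
      ⋃ k ∈ Finset.range n, ξ k ⁻¹' Metric.closedBall u (ρ n) := by
    rintro ω ⟨k, hk, h⟩
    refine Set.mem_biUnion hk ?_
    rwa [Set.mem_preimage, Metric.mem_closedBall, dist_comm, dist_eq_norm]
  refine (measure_mono hsub).trans ((measure_biUnion_finset_le _ _).trans ?_)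
  have hk : ∀ k ∈ Finset.range n, μ (ξ k ⁻¹' Metric.closedBall u (ρ n)) ≤
      ENNReal.ofReal (C * ρ n ^ 2) := by
    intro k _
    rw [← Measure.map_apply_of_aemeasurable (hident k).aemeasurable_fst measurableSet_closedBall,
      (hident k).map_eq]
    exact H _ hn0 hn
  refine (Finset.sum_le_sum hk).trans (le_of_eq ?_)
  rw [Finset.sum_const, Finset.card_range, nsmul_eq_mul, ← ENNReal.ofReal_natCast,
    ← ENNReal.ofReal_mul (Nat.cast_nonneg n), mul_pow, Real.sq_sqrt (Nat.cast_nonneg n)]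
  congr 1
  ring

/-- The sum of the squares `1 / ‖u - ξ k‖ ^ 2` is `o(n ^ (3 / 2))` in probability. -/
theorem tendsto_measure_sum_inv_sq_ge {Ω : Type*} [MeasurableSpace Ω] {μ : Measure Ω}
    [IsProbabilityMeasure μ]
    {ξ : ℕ → Ω → ℂ} (hident : ∀ k, IdentDistrib (ξ k) (ξ 0) μ μ)
    {u : ℂ} {p : ℂ → ℝ} {δ : ℝ} (hδ : 0 < δ)
    (hdens : HasLebesgueDensityOn (μ.map (ξ 0)) p (Metric.closedBall u δ))
    (hp : ContinuousAt p u) {ε : ℝ} (hε : 0 < ε) :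
    Tendsto (fun n : ℕ => μ {ω | ε ≤ (∑ k ∈ Finset.range n, 1 / ‖u - ξ k ω‖ ^ 2) / (n * √(n : ℝ))})
      atTop (𝓝 0) := by
  have hm : ∀ k, AEMeasurable (ξ k) μ := fun k => (hident k).aemeasurable_fst
  have hν : IsProbabilityMeasure (μ.map (ξ 0)) := Measure.isProbabilityMeasure_map (hm 0)
  set κ := (μ.map (ξ 0)).map fun x => 1 / (u - x) with hκ
  have hκp : IsProbabilityMeasure κ := Measure.isProbabilityMeasure_map (by fun_prop)
  have hYm : Measurable fun x : ℂ => 1 / (u - x) := by fun_prop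
  set M : ℝ → ℝ := fun b => ∫ y in Metric.closedBall 0 b, ‖y‖ ^ 2 ∂κ with hM
  have hMlim : Tendsto (fun b => M b / Real.log b) atTop (𝓝 (2 * Real.pi * p u)) :=
    hdens.tendsto_truncated_norm_sq hδ hp
  -- Unless some point is within $1/n$ of $u$, truncating $1/(u-\xi_k)$ at level $n$ changes
  -- nothing. Markov's inequality then applies to the truncated sum, whose terms have mean
  -- $M(n)=O(\log n)$.
  have hclose := tendsto_measure_exists_norm_sub_le (ρ := fun n : ℕ => 1 / (n : ℝ)) hident hδ hdens
    hp (Eventually.of_forall fun n => by positivity) (by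
      have h1 : Tendsto (fun n : ℕ => 1 / √(n : ℝ)) atTop (𝓝 0) :=
        (Real.tendsto_sqrt_atTop.comp tendsto_natCast_atTop_atTop).const_div_atTop 1
      refine h1.congr fun n => ?_
      rw [mul_one_div, Real.sqrt_div_self', one_div])
  have hlogsqrt : Tendsto (fun n : ℕ => Real.log n / √(n : ℝ)) atTop (𝓝 0) := by
    have h1 := (Real.tendsto_pow_log_div_mul_add_atTop 1 0 1 one_ne_zero).comp
      (Real.tendsto_sqrt_atTop.comp tendsto_natCast_atTop_atTop)
    have h2 := h1.const_mul 2
    rw [mul_zero] at h2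
    refine h2.congr fun n => ?_
    simp only [Function.comp_apply, pow_one, one_mul, add_zero]
    rw [Real.log_sqrt (Nat.cast_nonneg n)]
    ring
  have hMn : Tendsto (fun n : ℕ => M n / √(n : ℝ)) atTop (𝓝 0) := by
    have h1 := (hMlim.comp tendsto_natCast_atTop_atTop).mul hlogsqrt
    rw [mul_zero] at h1
    refine h1.congr' ?_
    filter_upwards [eventually_gt_atTop 1] with n hn
    have : 0 < Real.log n := Real.log_pos (by exact_mod_cast hn)
    simp only [Function.comp_apply]
    field_simp
  have hlim : Tendsto (fun n : ℕ => ENNReal.ofReal (M n / √(n : ℝ) / ε)) atTop (𝓝 0) := by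
    have := ENNReal.tendsto_ofReal (hMn.div_const ε)
    simpa using this
  have hsum := hclose.add hlim
  rw [add_zero] at hsum
  refine tendsto_of_tendsto_of_tendsto_of_le_of_le' tendsto_const_nhds hsum
    (Eventually.of_forall fun _ => zero_le) ?_
  filter_upwards [eventually_gt_atTop 0] with n hn
  have hn0 : (0 : ℝ) < n := by exact_mod_cast hn
  set φ : ℂ → ℝ := (Metric.closedBall 0 (n : ℝ)).indicator fun y => ‖y‖ ^ 2 with hφ
  have hφm : Measurable φ := Measurable.indicator (by fun_prop) measurableSet_closedBall
  have hφ0 : ∀ y, 0 ≤ φ y := fun y => Set.indicator_nonneg (fun y _ => by positivity) y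
  have hφi : Integrable φ κ := by
    rw [hφ, integrable_indicator_iff measurableSet_closedBall]
    refine IntegrableOn.of_bound (measure_lt_top _ _)
      (Measurable.aestronglyMeasurable (by fun_prop)) ((n : ℝ) ^ 2) ?_
    refine (ae_restrict_iff' measurableSet_closedBall).2 (ae_of_all _ fun y hy => ?_)
    rw [mem_closedBall_zero_iff] at hy
    rw [norm_pow, norm_norm]
    gcongr
  have hmapk : ∀ k, μ.map (fun ω => 1 / (u - ξ k ω)) = κ := by
    intro k
    rw [hκ, ← (hident k).map_eq, AEMeasurable.map_map_of_aemeasurable hYm.aemeasurable (hm k)]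
    rfl
  have hYkm : ∀ k, AEMeasurable (fun ω => 1 / (u - ξ k ω)) μ := fun k =>
    hYm.comp_aemeasurable (hm k)
  have hki : ∀ k, Integrable (fun ω => φ (1 / (u - ξ k ω))) μ := by
    intro k
    have : Integrable φ (μ.map fun ω => 1 / (u - ξ k ω)) := by rwa [hmapk k]
    exact this.comp_aemeasurable (hYkm k)
  have hkv : ∀ k, ∫ ω, φ (1 / (u - ξ k ω)) ∂μ = M n := by
    intro k
    rw [← integral_map (hYkm k) (f := φ) hφm.aestronglyMeasurable, hmapk k, hφ,
      integral_indicator measurableSet_closedBall]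
  set F : Ω → ℝ := fun ω => (∑ k ∈ Finset.range n, φ (1 / (u - ξ k ω))) / (n * √(n : ℝ)) with hF
  have hFi : Integrable F μ := (integrable_finsetSum _ fun k _ => hki k).div_const _
  have hFv : ∫ ω, F ω ∂μ = M n / √(n : ℝ) := by
    rw [hF, integral_div, integral_finsetSum _ fun k _ => hki k]
    simp only [hkv, Finset.sum_const, Finset.card_range, nsmul_eq_mul]
    have : 0 < √(n : ℝ) := Real.sqrt_pos.2 hn0
    field_simp
  have hmarkov : μ {ω | ε ≤ F ω} ≤ ENNReal.ofReal (M n / √(n : ℝ) / ε) := by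
    have h1 := mul_meas_ge_le_integral_of_nonneg (ae_of_all _ fun ω => div_nonneg
      (Finset.sum_nonneg fun k _ => hφ0 _) (by positivity)) hFi ε
    rw [hFv, mul_comm, ← le_div_iff₀ hε] at h1
    rw [← ofReal_measureReal]
    exact ENNReal.ofReal_le_ofReal h1
  refine le_trans (measure_mono ?_) ((measure_union_le _ _).trans (add_le_add le_rfl hmarkov))
  intro ω hω
  by_cases hc : ∃ k ∈ Finset.range n, ‖u - ξ k ω‖ ≤ 1 / (n : ℝ)
  · exact Or.inl hc
  · right
    push Not at hc
    have : F ω = (∑ k ∈ Finset.range n, 1 / ‖u - ξ k ω‖ ^ 2) / (n * √(n : ℝ)) := by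
      simp only [hF]
      congr 1
      refine Finset.sum_congr rfl fun k hk => ?_
      have h1 := hc k hk
      have h2 : 0 < ‖u - ξ k ω‖ := lt_trans (by positivity) h1
      rw [hφ, Set.indicator_of_mem]
      · rw [norm_div, norm_one, div_pow, one_pow]
      · rw [mem_closedBall_zero_iff, norm_div, norm_one, div_le_iff₀ h2]
        rw [div_lt_iff₀ hn0] at h1
        linarith
    change ε ≤ F ω
    rw [this]
    exact hω

/-- The weak law of large numbers for `1 / (u - ξ k)`. -/
theorem tendsto_measure_norm_average_sub_ge {Ω : Type*} [MeasurableSpace Ω] {μ : Measure Ω}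
    [IsProbabilityMeasure μ] {Y : ℕ → Ω → ℂ} (hindep : iIndepFun Y μ)
    (hident : ∀ k, IdentDistrib (Y k) (Y 0) μ μ) (hint : Integrable (Y 0) μ) {ε : ℝ} (hε : 0 < ε) :
    Tendsto (fun n : ℕ => μ {ω | ε ≤ ‖(∑ k ∈ Finset.range n, Y k ω) / n - ∫ ω, Y 0 ω ∂μ‖})
      atTop (𝓝 0) := by
  have h := strong_law_ae Y hint (fun i j hij => hindep.indepFun hij) hident
  have hm : ∀ n : ℕ, AEStronglyMeasurable
      (fun ω => (n : ℝ)⁻¹ • ∑ k ∈ Finset.range n, Y k ω) μ := fun n =>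
    ((Finset.aemeasurable_fun_sum _ fun k _ =>
      (hident k).aemeasurable_fst).fun_const_smul _).aestronglyMeasurable
  have h2 := tendstoInMeasure_iff_norm.1 (tendstoInMeasure_of_tendsto_ae hm h) ε hε
  refine h2.congr fun n => ?_
  congr 1
  ext ω
  have : (n : ℝ)⁻¹ • ∑ k ∈ Finset.range n, Y k ω = (∑ k ∈ Finset.range n, Y k ω) / n := by
    rw [Complex.real_smul]
    push_cast
    rw [inv_mul_eq_div]
  rw [Set.mem_ofPred_eq, Set.mem_ofPred_eq, this]

/-! ### Expansion of the critical point and the limit law -/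

/-- Existence, uniqueness and first order expansion of the critical point near the pinned zero,
on an explicit event. -/
theorem criticalPoint_expansion {u f : ℂ} (hf : f ≠ 0) {x : ℕ → ℂ} {n : ℕ} (hn : 3 ≤ n)
    {r : ℝ} (hr : 0 < r) (hx : ∀ k ∈ Finset.range n, 2 * r ≤ ‖u - x k‖)
    (hS : ‖(∑ k ∈ Finset.range n, 1 / (u - x k)) / n - f‖ ≤ ‖f‖ / 2)
    (hT : (∑ k ∈ Finset.range n, 1 / ‖u - x k‖ ^ 2) / (n * √(n : ℝ)) ≤ 1)
    (hr1 : 32 * (√(n : ℝ) * r) ≤ ‖f‖) (hr2 : 4 ≤ ‖f‖ * (n * r)) :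
    HasUniqueCriticalPoint (pinnedPoly u x n) u r ∧
      ∀ ζ ∈ Metric.closedBall u r, (pinnedPoly u x n).derivative.eval ζ = 0 →
        ‖-f * n * (ζ - u) - 1‖ ≤
          4 / ‖f‖ * ‖(∑ k ∈ Finset.range n, 1 / (u - x k)) / n - f‖ +
          32 / ‖f‖ ^ 2 * ((∑ k ∈ Finset.range n, 1 / ‖u - x k‖ ^ 2) / (n * √(n : ℝ))) ∧
        ‖f ^ 2 * ((√((n : ℝ) / Real.log n) : ℝ) : ℂ) * (n * (ζ - u) + 1 / f) -
          (-f * n * (ζ - u)) * ((√(n * Real.log n))⁻¹ •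
            (∑ k ∈ Finset.range n, 1 / (u - x k) - n * f))‖ ≤
          32 / ‖f‖ * ((∑ k ∈ Finset.range n, 1 / ‖u - x k‖ ^ 2) / (n * √(n : ℝ))) := by
  set S : ℂ := ∑ k ∈ Finset.range n, 1 / (u - x k) with hSdef
  set T : ℝ := ∑ k ∈ Finset.range n, 1 / ‖u - x k‖ ^ 2 with hTdef
  set τ := T / (n * √(n : ℝ)) with hτ
  set L := ‖S / n - f‖ with hL
  have hn1 : (3 : ℝ) ≤ n := by exact_mod_cast hn
  have hn0 : (0 : ℝ) < n := by linarith
  have hnC : (n : ℂ) ≠ 0 := by exact_mod_cast hn0.ne'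
  have hf0 : 0 < ‖f‖ := norm_pos_iff.2 hf
  set q := √(n : ℝ) with hq
  have hq1 : 1 ≤ q := Real.one_le_sqrt.2 (by linarith)
  have hq2 : q * q = n := Real.mul_self_sqrt hn0.le
  have hT0 : 0 ≤ T := Finset.sum_nonneg fun k _ => by positivity
  have hτ0 : 0 ≤ τ := by positivity
  have hTτ : T = τ * (n * q) := by rw [hτ]; field_simp
  have hSL : ‖S - n * f‖ = n * L := by
    have : S - n * f = n * (S / n - f) := by field_simp
    rw [this, norm_mul, Complex.norm_natCast]
  -- The deterministic criterion is applied with $c=\|f\|n/2$; the constants $32$ and $4$ in `hr1`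
  -- and `hr2` are what its two conditions on $r$ then require.
  have hc : 0 < ‖f‖ / 2 * n := by positivity
  have hSc : ‖f‖ / 2 * n ≤ ‖S‖ := by
    have h1 : ‖(n : ℂ) * f‖ ≤ ‖S‖ + ‖S - n * f‖ := by
      have := norm_sub_le S (S - n * f)
      rwa [sub_sub_cancel] at this
    rw [norm_mul, Complex.norm_natCast, hSL] at h1
    nlinarith
  have hTc : 16 * r * T ≤ ‖f‖ / 2 * n := by
    have h1 : τ * (32 * (q * r)) ≤ 1 * ‖f‖ := by gcongr
    rw [hTτ]
    nlinarith
  obtain ⟨h1, h2⟩ := hasUniqueCriticalPoint_of_bounds u x n hr hc hx hSc hTc (by linarith)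
  refine ⟨h1, fun ζ hζ hζ0 => ?_⟩
  obtain ⟨g, hgS, hgl, hg⟩ := h2 ζ hζ hζ0
  rw [← hSdef, ← hTdef] at hgS
  have hgS' : ‖g - S‖ ≤ 8 / ‖f‖ * (τ * q) := by
    refine hgS.trans (le_of_eq ?_)
    rw [hTτ]
    field_simp
    ring
  have hgpos : 0 < ‖g‖ := by linarith
  have hg0 : g ≠ 0 := norm_pos_iff.1 hgpos
  have hd : ζ - u = -1 / g := by rw [← hg]; field_simp
  have hA : ‖-f * n * (ζ - u)‖ ≤ 4 := by
    have e : -f * n * (ζ - u) = f * n / g := by rw [hd]; ring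
    rw [e, norm_div, norm_mul, Complex.norm_natCast, div_le_iff₀ hgpos]
    linarith
  constructor
  · have e : -f * n * (ζ - u) - 1 = -((g - S) + (S - n * f)) / g := by
      rw [hd]; field_simp; ring
    rw [e, norm_div, norm_neg, div_le_iff₀ hgpos]
    calc ‖g - S + (S - n * f)‖ ≤ 8 / ‖f‖ * (τ * q) + n * L := by
          refine (norm_add_le _ _).trans ?_
          rw [hSL]
          gcongr
      _ ≤ 8 / ‖f‖ * (τ * n) + n * L := by
          gcongr
          nlinarith
      _ = (4 / ‖f‖ * L + 32 / ‖f‖ ^ 2 * τ) * (‖f‖ / 2 * n / 2) := by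
          field_simp
          ring
      _ ≤ _ := by
          gcongr
  -- Here $n\ge3>e$ matters: $\log n\ge1$ gives $\sqrt n\le s$, so an error of size $\tau\sqrt n$
  -- divided by $s$ is at most $\tau$.
  · have hlog : 1 ≤ Real.log n := by
      rw [Real.le_log_iff_exp_le hn0]
      linarith [Real.exp_one_lt_d9]
    have hl0 : 0 < Real.log n := by linarith
    set s := √(n * Real.log n) with hs
    have hs0 : 0 < s := Real.sqrt_pos.2 (by positivity)
    have hqs : q ≤ s := Real.sqrt_le_sqrt (by nlinarith)
    have hns : √((n : ℝ) / Real.log n) = n / s := by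
      rw [hs, Real.sqrt_div hn0.le, Real.sqrt_mul hn0.le, ← hq]
      have : 0 < √(Real.log n) := Real.sqrt_pos.2 hl0
      field_simp
      nlinarith
    have hsC : (s : ℂ) ≠ 0 := by exact_mod_cast hs0.ne'
    have e : f ^ 2 * ((√((n : ℝ) / Real.log n) : ℝ) : ℂ) * (n * (ζ - u) + 1 / f) -
        (-f * n * (ζ - u)) * (s⁻¹ • (S - n * f)) = (-f * n * (ζ - u)) * ((g - S) / s) := by
      rw [hns, hd, Complex.real_smul]
      push_cast
      field_simp
      ring
    rw [e, norm_mul, norm_div, Complex.norm_of_nonneg hs0.le]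
    calc ‖-f * n * (ζ - u)‖ * (‖g - S‖ / s) ≤ 4 * (8 / ‖f‖ * (τ * q) / q) := by gcongr
      _ = 32 / ‖f‖ * τ := by
          have : q ≠ 0 := by linarith
          field_simp
          ring

theorem theorem2p2 {Ω : Type*} [MeasurableSpace Ω] (μ : Measure Ω) [IsProbabilityMeasure μ]
    (ξ : ℕ → Ω → ℂ) (h_indep : iIndepFun ξ μ)
    (h_ident : ∀ k, IdentDistrib (ξ k) (ξ 0) μ μ)
    (u₀ : ℂ) (p : ℂ → ℝ) (δ : ℝ) (hδ : 0 < δ)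
    (h_dens : HasLebesgueDensityOn (μ.map (ξ 0)) p (Metric.closedBall u₀ δ))
    (h_cont : ContinuousAt p u₀)
    (hf : cauchyStieltjes μ (ξ 0) u₀ ≠ 0)
    (r : ℕ → ℝ) (hr_pos : ∀ n, 1 ≤ n → 0 < r n)
    (hr_top : Tendsto (fun n : ℕ => (n : ℝ) * r n) atTop atTop)
    (hr_zero : Tendsto (fun n : ℕ => Real.sqrt (n : ℝ) * r n) atTop (𝓝 0)) :
    Tendsto
      (fun n : ℕ => μ {ω | HasUniqueCriticalPoint (pinnedPoly u₀ (fun k => ξ k ω) n) u₀ (r n)})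
      atTop (𝓝 1) ∧
    ∀ a : ℕ → Ω → ℂ, (∀ n, AEMeasurable (a n) μ) →
      ∀ ζ : ℕ → Ω → ℂ,
        (∀ n ω, ζ n ω = criticalPointOr (pinnedPoly u₀ (fun k => ξ k ω) n) u₀ (r n) (a n ω)) →
        TendstoInDistribution
          (fun (n : ℕ) ω => (cauchyStieltjes μ (ξ 0) u₀) ^ 2
            * ((Real.sqrt ((n : ℝ) / Real.log (n : ℝ)) : ℝ) : ℂ)
            * ((n : ℂ) * (ζ n ω - u₀) + 1 / cauchyStieltjes μ (ξ 0) u₀))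
          atTop (fun z : ℂ => z) (fun _ => μ) (complexNormal (Real.toNNReal (Real.pi * p u₀))) := by
  have hm : ∀ k, AEMeasurable (ξ k) μ := fun k => (h_ident k).aemeasurable_fst
  have hν : IsProbabilityMeasure (μ.map (ξ 0)) := Measure.isProbabilityMeasure_map (hm 0)
  have hgm : Measurable fun x : ℂ => 1 / (u₀ - x) := by fun_prop
  set f := cauchyStieltjes μ (ξ 0) u₀ with hfdef
  have hf0 : 0 < ‖f‖ := norm_pos_iff.2 hf
  set Y : ℕ → Ω → ℂ := fun k ω => 1 / (u₀ - ξ k ω) with hY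
  have hYindep : iIndepFun Y μ := h_indep.comp (fun _ x => 1 / (u₀ - x)) fun _ => hgm
  have hYident : ∀ k, IdentDistrib (Y k) (Y 0) μ μ := fun k => (h_ident k).comp hgm
  have hYint : Integrable (Y 0) μ := by
    -- A non-integrable function has Bochner integral $0$, contradicting $f\ne0$.
    by_contra h
    exact hf (integral_undef h)
  have hYf : ∫ ω, Y 0 ω ∂μ = f := rfl
  have hYlaw : μ.map (Y 0) = (μ.map (ξ 0)).map fun x => 1 / (u₀ - x) := by
    rw [AEMeasurable.map_map_of_aemeasurable hgm.aemeasurable (hm 0)]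
    rfl
  have hp0 := h_dens.nonneg_center hδ
  have hCLT := tendstoInDistribution_sum_sub_of_log_second_moment hYindep hYident hYint
    (v := Real.pi * p u₀) (by positivity)
    (by rw [hYlaw]; exact h_dens.tendsto_truncated_second_moment hδ h_cont)
    (by
      rw [hYlaw]
      obtain ⟨C, -, hC⟩ := h_dens.exists_tail_integral_le hδ h_cont
      exact ⟨C, hC⟩)
  rw [hYf] at hCLT
  set L : ℕ → Ω → ℝ := fun n ω => ‖(∑ k ∈ Finset.range n, Y k ω) / n - f‖ with hL
  set τ : ℕ → Ω → ℝ := fun n ω =>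
    (∑ k ∈ Finset.range n, 1 / ‖u₀ - ξ k ω‖ ^ 2) / (n * √(n : ℝ)) with hτ
  have hLlim : ∀ ε > 0, Tendsto (fun n => μ {ω | ε ≤ L n ω}) atTop (𝓝 0) := fun ε hε =>
    tendsto_measure_norm_average_sub_ge hYindep hYident hYint hε
  have hτlim : ∀ ε > 0, Tendsto (fun n => μ {ω | ε ≤ τ n ω}) atTop (𝓝 0) := fun ε hε =>
    tendsto_measure_sum_inv_sq_ge h_ident hδ h_dens h_cont hε
  have hclose := tendsto_measure_exists_norm_sub_le (ρ := fun n : ℕ => 2 * r n) h_ident hδ h_dens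
    h_cont ((eventually_ge_atTop 1).mono fun n hn => by linarith [hr_pos n hn]) (by
      have := hr_zero.const_mul 2
      rw [mul_zero] at this
      exact this.congr fun n => by ring)
  set bad : ℕ → Set Ω := fun n => {ω | ∃ k ∈ Finset.range n, ‖u₀ - ξ k ω‖ ≤ 2 * r n} ∪
    ({ω | ‖f‖ / 2 ≤ L n ω} ∪ {ω | 1 ≤ τ n ω}) with hbad
  have hbadlim : Tendsto (fun n => μ (bad n)) atTop (𝓝 0) :=
    tendsto_measure_union_zero hclose
      (tendsto_measure_union_zero (hLlim _ (by positivity)) (hτlim 1 one_pos))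
  have hgood : ∀ᶠ n in atTop, ∀ ω ∉ bad n,
      HasUniqueCriticalPoint (pinnedPoly u₀ (fun k => ξ k ω) n) u₀ (r n) ∧
      ∀ ζ ∈ Metric.closedBall u₀ (r n),
        (pinnedPoly u₀ (fun k => ξ k ω) n).derivative.eval ζ = 0 →
        ‖-f * n * (ζ - u₀) - 1‖ ≤ 4 / ‖f‖ * L n ω + 32 / ‖f‖ ^ 2 * τ n ω ∧
        ‖f ^ 2 * ((√((n : ℝ) / Real.log n) : ℝ) : ℂ) * (n * (ζ - u₀) + 1 / f) -
          (-f * n * (ζ - u₀)) * ((√(n * Real.log n))⁻¹ •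
            (∑ k ∈ Finset.range n, Y k ω - n * f))‖ ≤ 32 / ‖f‖ * τ n ω := by
    filter_upwards [eventually_ge_atTop 3,
      (hr_zero.const_mul 32).eventually_le_const (by rwa [mul_zero]),
      (hr_top.const_mul_atTop hf0).eventually_ge_atTop 4] with n hn h1 h2 ω hω
    simp only [hbad, Set.mem_union, not_or, Set.mem_ofPred_eq, not_exists, not_and, not_le] at hω
    exact criticalPoint_expansion hf hn (hr_pos n (by omega)) (fun k hk => (hω.1 k hk).le)
      hω.2.1.le hω.2.2.le h1 h2
  constructor
  · have hlim : Tendsto (fun n => 1 - μ (bad n)) atTop (𝓝 1) := by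
      have := ENNReal.Tendsto.sub (tendsto_const_nhds (x := (1 : ℝ≥0∞))) hbadlim
        (Or.inl ENNReal.one_ne_top)
      simpa using this
    refine tendsto_of_tendsto_of_tendsto_of_le_of_le' hlim tendsto_const_nhds ?_
      (Eventually.of_forall fun n => prob_le_one)
    filter_upwards [hgood] with n hn
    rw [tsub_le_iff_right, ← measure_univ (μ := μ)]
    refine (measure_mono fun ω _ => ?_).trans (measure_union_le _ _)
    by_cases hω : ω ∈ bad n
    · exact Or.inr hω
    · exact Or.inl (hn ω hω).1
  · intro a ha ζ hζ
    have hζm : ∀ n, AEMeasurable (ζ n) μ := fun n => by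
      rw [funext (hζ n)]
      exact aemeasurable_criticalPointOr hm (ha n) u₀ n (r n)
    have hζgood : ∀ᶠ n in atTop, ∀ ω ∉ bad n,
        ‖-f * n * (ζ n ω - u₀) - 1‖ ≤ 4 / ‖f‖ * L n ω + 32 / ‖f‖ ^ 2 * τ n ω ∧
        ‖f ^ 2 * ((√((n : ℝ) / Real.log n) : ℝ) : ℂ) * (n * (ζ n ω - u₀) + 1 / f) -
          (-f * n * (ζ n ω - u₀)) * ((√(n * Real.log n))⁻¹ •
            (∑ k ∈ Finset.range n, Y k ω - n * f))‖ ≤ 32 / ‖f‖ * τ n ω := by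
      filter_upwards [hgood] with n hn ω hω
      obtain ⟨h1, h2⟩ := hn ω hω
      have h3 := criticalPointOr_spec (a n ω) h1
      rw [← hζ n ω] at h3
      exact h2 _ h3.1 h3.2
    have hAm : ∀ n : ℕ, AEMeasurable (fun ω => -f * n * (ζ n ω - u₀)) μ := fun n =>
      ((hζm n).sub_const u₀).const_mul _
    have hA : TendstoInMeasure μ (fun (n : ℕ) ω => -f * n * (ζ n ω - u₀)) atTop (fun _ => 1) := by
      refine tendstoInMeasure_iff_norm.2 fun ε hε => ?_
      refine tendsto_measure_zero_of_subset ?_ (tendsto_measure_union_zero hbadlim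
        (tendsto_measure_union_zero (hLlim (‖f‖ / 4 * (ε / 2)) (by positivity))
          (hτlim (‖f‖ ^ 2 / 32 * (ε / 2)) (by positivity))))
      filter_upwards [hζgood] with n hn ω hω
      by_contra hc
      simp only [Set.mem_union, not_or, Set.mem_ofPred_eq, not_le] at hc
      have h1 := (hn ω hc.1).1
      have h2 : 4 / ‖f‖ * L n ω < 4 / ‖f‖ * (‖f‖ / 4 * (ε / 2)) := by gcongr; exact hc.2.1
      have h3 : 32 / ‖f‖ ^ 2 * τ n ω < 32 / ‖f‖ ^ 2 * (‖f‖ ^ 2 / 32 * (ε / 2)) := by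
        gcongr; exact hc.2.2
      have e2 : 4 / ‖f‖ * (‖f‖ / 4 * (ε / 2)) = ε / 2 := by field_simp
      have e3 : 32 / ‖f‖ ^ 2 * (‖f‖ ^ 2 / 32 * (ε / 2)) = ε / 2 := by field_simp
      have h4 : ε ≤ ‖-f * n * (ζ n ω - u₀) - 1‖ := hω
      linarith
    -- Slutsky: the factor $-fn(\zeta_n-u_0)$ tends to $1$ in probability, so the product keeps the
    -- limit law of the normalized sum.
    have hAX := hCLT.continuous_comp_prodMk_of_tendstoInMeasure_const
      (g := fun q : ℂ × ℂ => q.2 * q.1) (by fun_prop) hA hAm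
    simp only [one_mul] at hAX
    refine tendstoInDistribution_of_tendstoInMeasure_sub _ _ hAX ?_ fun n => ?_
    · refine tendstoInMeasure_iff_norm.2 fun ε hε => ?_
      refine tendsto_measure_zero_of_subset ?_ (tendsto_measure_union_zero hbadlim
        (hτlim (‖f‖ / 32 * ε) (by positivity)))
      filter_upwards [hζgood] with n hn ω hω
      by_contra hc
      simp only [Set.mem_union, not_or, Set.mem_ofPred_eq, not_le] at hc
      have h1 := (hn ω hc.1).2
      have h3 : 32 / ‖f‖ * τ n ω < 32 / ‖f‖ * (‖f‖ / 32 * ε) := by gcongr; exact hc.2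
      have e3 : 32 / ‖f‖ * (‖f‖ / 32 * ε) = ε := by field_simp
      simp only [Set.mem_ofPred_eq, Pi.sub_apply, Pi.zero_apply, sub_zero] at hω
      linarith
    · exact (((hζm n).sub_const u₀).const_mul _ |>.add_const _).const_mul _
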